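/- **Setting.** Let $p:M\to B$ be a smooth map of smooth Hausdorff manifolds (finite-dimensional, without boundary), and let $\mathrm{Ver}=\ker dp$. Write $\Omega^q(\mathrm{Ver})$ for the vertical $q$-forms, $d_V$ for the vertical de Rham differential on them, and $\Omega^a(B,\Omega^q(\mathrm{Ver}))$ for the $a$-forms on $B$ with values in vertical $q$-forms, i.e. the alternating $C^\infty(B)$-multilinear maps $\mathfrak X(B)^a\to\Omega^q(\mathrm{Ver})$. An Ehresmann connection is a smooth splitting $TM=\mathrm{Ver}\oplus\mathrm{Hor}$ such that every $u\in\mathfrak X(B)$ has a (unique) horizontal lift $h(u)$; its curvature is $C(u,v)=[h(u),h(v)]-h([u,v])\in\Gamma(\mathrm{Ver})$. It is complete if every smooth path in $B$ has a horizontal lift through each point over its initial point. A *fibration* is a smooth submersion that admits a complete Ehresmann connection. For $\Theta\in\Omega^a(B,\Omega^q(\mathrm{Ver}))$ put $d^V\Theta=(-1)^a\,d_V\circ\Theta$, and, for a connection, $$(d^H\Theta)(v_0,\dots,v_a)=\sum_i(-1)^i L_{h(v_i)}\bigl(\Theta(\dots\widehat{v_i}\dots)\bigr)+\sum_{i<j}(-1)^{i+j}\Theta([v_i,v_j],\dots\widehat{v_i}\dots\widehat{v_j}\dots),$$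 $$(d^C\Theta)(v_0,\dots,v_{a+1})=(-1)^a\sum_{i<j}(-1)^{i+j}\,i_{C(v_i,v_j)}\,\Theta(\dots\widehat{v_i}\dots\widehat{v_j}\dots).$$ Let $\Omega^a(B,H^q(\mathrm{Ver})):=E_1^{a,q}$ be the cohomology of $d^V$ on $\Omega^a(B,\Omega^q(\mathrm{Ver}))$, with classes $[\,\cdot\,]_1$. Since $d^Vd^H=-d^Hd^V$, the operator $d^H$ induces $d_1:E_1^{a,q}\to E_1^{a+1,q}$. Let $H^a(B,H^q(\mathrm{Ver})):=E_2^{a,q}=\ker d_1/\operatorname{im}d_1$, with classes $[\,\cdot\,]_2$. A *$2$-plectic fibration* is a fibration $p:M\to B$ with a form $\Phi_V\in\Omega^3(\mathrm{Ver})$ that is vertically closed ($d_V\Phi_V=0$) and non-degenerate ($i_X\Phi_V=0\Rightarrow X=0$ for $X\in\mathrm{Ver}$), and that admits a *compatible* connection, i.e. one with $d^H\Phi_V=0$. **Proposition.** Let $(p:M\to B,\Phi_V)$ be a $2$-plectic fibration. 1. For every compatible connection, $d^V d^C\Phi_V=0$ and $d_1[d^C\Phi_V]_1=0$, so the class $[d^C\Phi_V]_2\in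 H^2(B,H^2(\mathrm{Ver}))$ is defined. It vanishes if and only if there exist $\alpha^\star_H\in\Omega^1(B,\Omega^2(\mathrm{Ver}))$ and $\omega^\star_H\in\Omega^2(B,\Omega^1(\mathrm{Ver}))$ with $$d^H\Phi_V+d^V\alpha^\star_H=0,\qquad d^C\Phi_V+d^H\alpha^\star_H+d^V\omega^\star_H=0 .$$ It is an obstruction to a closed extension: if there is a closed form $\Phi\in\Omega^3(M)$ whose restriction to $\mathrm{Ver}$ is $\Phi_V$, then $[d^C\Phi_V]_2=0$. 2. The differential $d_1$, and hence $H^a(B,H^q(\mathrm{Ver}))$, does not depend on the chosen Ehresmann connection, and the class $[d^C\Phi_V]_2$ does not depend on the compatible connection. -/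

import Mathlib

open scoped Manifold ContDiff
open VectorField

noncomputable section
set_option linter.unusedSectionVars false

section VF
variable (E M : Type*) [NormedAddCommGroup E] [NormedSpace ℝ E]
  [TopologicalSpace M] [ChartedSpace E M] [IsManifold 𝓘(ℝ, E) ∞ M]

/-- `C^∞(M)` -/
abbrev SmoothFn := C^∞⟮𝓘(ℝ, E), M; ℝ⟯
/-- The smooth vector fields on `M`. -/
abbrev VField := Cₛ^∞⟮𝓘(ℝ, E); E, (TangentSpace 𝓘(ℝ, E) : M → Type _)⟯

variable {E M}

namespace VField

instance instSMulFn : SMul (SmoothFn E M) (VField E M) :=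
  ⟨fun f X => ⟨fun x => f x • X x, f.contMDiff.smul_section X.contMDiff⟩⟩

@[simp] lemma smulFn_apply (f : SmoothFn E M) (X : VField E M) (x : M) :
    (f • X) x = f x • X x := rfl

instance instModuleFn : Module (SmoothFn E M) (VField E M) where
  one_smul X := by ext x; simp
  mul_smul f g X := by ext x; simp [mul_smul]
  smul_zero f := by ext x; simp
  zero_smul X := by ext x; simp
  smul_add f X Y := by ext x; simp
  add_smul f g X := by ext x; simp [add_smul]

instance instIsScalarTower : IsScalarTower ℝ (SmoothFn E M) (VField E M) where
  smul_assoc c f X := by ext x; simp [mul_smul]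

section Lie

variable [FiniteDimensional ℝ E]

/-- The Lie bracket of vector fields. -/
instance instBracket : Bracket (VField E M) (VField E M) :=
  ⟨fun X Y => ⟨mlieBracket 𝓘(ℝ, E) X Y, by
    have : IsManifold 𝓘(ℝ, E) (((⊤ : ℕ∞) : ℕ∞ω) + 1) M := by
      simpa using ‹IsManifold 𝓘(ℝ, E) ∞ M›
    have : IsManifold 𝓘(ℝ, E) (minSmoothness ℝ 2) M := by
      rw [minSmoothness_of_isRCLikeNormedField]
      exact IsManifold.of_le (n := ∞) ENat.LEInfty.out
    have := FiniteDimensional.complete ℝ E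
    exact ContDiff.mlieBracket_vectorField (n := ⊤) X.contMDiff Y.contMDiff (by simp)⟩⟩

lemma lie_apply (X Y : VField E M) (x : M) :
   ⁅X, Y⁆ x = mlieBracket 𝓘(ℝ, E) X Y x := rfl

instance instLieRing : LieRing (VField E M) where
  add_lie X Y Z := by
    have := FiniteDimensional.complete ℝ E
    ext x
    exact mlieBracket_add_left X.mdifferentiableAt Y.mdifferentiableAt
  lie_add X Y Z := by
    have := FiniteDimensional.complete ℝ E
    ext x
    exact mlieBracket_add_right Y.mdifferentiableAt Z.mdifferentiableAt
  lie_self X := by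
    ext x
    have h := congrFun (mlieBracket_swap (I := 𝓘(ℝ, E)) (V := X) (W := X)) x
    rw [Pi.neg_apply] at h
    have h2 := add_eq_zero_iff_eq_neg.mpr h
    rw [← two_smul ℝ] at h2
    exact (smul_eq_zero.mp h2).resolve_left two_ne_zero
  leibniz_lie X Y Z := by
    have := FiniteDimensional.complete ℝ E
    have : IsManifold 𝓘(ℝ, E) (minSmoothness ℝ 3) M := by
      simp only [minSmoothness_of_isRCLikeNormedField]
      exact IsManifold.of_le (n := ∞) ENat.LEInfty.out
    ext x
    have h : ∀ U : VField E M, CMDiffAt (minSmoothness ℝ 2) (T% (fun x => U x)) x := fun U => by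
      simp only [minSmoothness_of_isRCLikeNormedField]
      exact (U.contMDiff x).of_le ENat.LEInfty.out
    exact leibniz_identity_mlieBracket_apply (h X) (h Y) (h Z)

instance instLieAlgebra : LieAlgebra ℝ (VField E M) where
  lie_smul c X Y := by
    have := FiniteDimensional.complete ℝ E
    ext x
    exact mlieBracket_const_smul_right Y.mdifferentiableAt

end Lie

/-- The derivative `X f` of a function along a vector field, written `⁅X, f⁆`. -/
instance instBracketFn : Bracket (VField E M) (SmoothFn E M) :=
  ⟨fun X f => ⟨fun x => mvfderiv 𝓘(ℝ, E) f x (X x), by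
    have h1 : CMDiff ∞ (tangentMap 𝓘(ℝ, E) 𝓘(ℝ, ℝ) f) :=
      f.contMDiff.contMDiff_tangentMap (by simp)
    exact ((contMDiff_snd_tangentBundle_modelSpace ℝ 𝓘(ℝ, ℝ)).comp h1).comp X.contMDiff⟩⟩

lemma lie_fn_apply (X : VField E M) (f : SmoothFn E M) (x : M) :
    ⁅X, f⁆ x = mvfderiv 𝓘(ℝ, E) f x (X x) := rfl

lemma add_lie_fn (X Y : VField E M) (f : SmoothFn E M) : ⁅X + Y, f⁆ = ⁅X, f⁆ + ⁅Y, f⁆ := by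
  ext x
  simp [lie_fn_apply]

lemma smul_lie_fn (g : SmoothFn E M) (X : VField E M) (f : SmoothFn E M) :
    ⁅g • X, f⁆ = g * ⁅X, f⁆ := by
  ext x
  simp [lie_fn_apply]

lemma lie_fn_add (X : VField E M) (f g : SmoothFn E M) : ⁅X, f + g⁆ = ⁅X, f⁆ + ⁅X, g⁆ := by
  ext x
  simp only [lie_fn_apply, ContMDiffMap.coe_add, Pi.add_apply]
  rw [mvfderiv_add f.mdifferentiableAt g.mdifferentiableAt]
  rfl

lemma lie_fn_mul (X : VField E M) (f g : SmoothFn E M) :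
    ⁅X, f * g⁆ = f * ⁅X, g⁆ + ⁅X, f⁆ * g := by
  ext x
  simp only [lie_fn_apply, ContMDiffMap.coe_add, Pi.add_apply, ContMDiffMap.coe_mul, Pi.mul_apply]
  rw [mvfderiv_mul f.mdifferentiableAt g.mdifferentiableAt]
  simp [mul_comm]

lemma lie_fn_smul (c : ℝ) (X : VField E M) (f : SmoothFn E M) : ⁅X, c • f⁆ = c • ⁅X, f⁆ := by
  ext x
  simp only [lie_fn_apply, ContMDiffMap.coe_smul, Pi.smul_apply]
  have : (c • ⇑f) = (fun _ : M => c) • ⇑f := rfl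
  rw [this, mvfderiv_smul mdifferentiableAt_const f.mdifferentiableAt, mvfderiv_const]
  simp

lemma lie_smul_fn [FiniteDimensional ℝ E] (X Y : VField E M) (f : SmoothFn E M) :
    ⁅X, f • Y⁆ = f • ⁅X, Y⁆ + ⁅X, f⁆ • Y := by
  have := FiniteDimensional.complete ℝ E
  ext x
  rw [add_comm]
  exact mlieBracket_smul_right f.mdifferentiableAt Y.mdifferentiableAt

/-- Every tangent vector extends to a smooth vector field. -/
lemma exists_apply_eq [FiniteDimensional ℝ E] [T2Space M] (x : M) (v : TangentSpace 𝓘(ℝ, E) x) :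
    ∃ X : VField E M, X x = v := by
  have : IsManifold 𝓘(ℝ, E) (∞ + 1) M := by simpa using ‹IsManifold 𝓘(ℝ, E) ∞ M›
  have := TangentBundle.contMDiffVectorBundle (I := 𝓘(ℝ, E)) (M := M) (n := ∞)
  obtain ⟨s, hs, hsm⟩ := FiberBundle.exists_contMDiffOn_extend (k := ∞) 𝓘(ℝ, E) E v
  obtain ⟨u, hus, hu, hxu⟩ := mem_nhds_iff.mp hs
  obtain ⟨ψ, -, hψ⟩ := (SmoothBumpFunction.nhds_basis_tsupport (I := 𝓘(ℝ, E)) x).mem_iff.mp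
    (hu.mem_nhds hxu)
  refine ⟨⟨_, ContMDiffOn.smul_section_of_tsupport (ψ := ψ) ψ.contMDiff.contMDiffOn hu hψ
    (hsm.mono hus)⟩, ?_⟩
  simp

/-- `[X, Y] f = X (Y f) - Y (X f)`. -/
lemma lie_lie_fn [FiniteDimensional ℝ E] [T2Space M] (X Y : VField E M) (f : SmoothFn E M) :
    ⁅⁅X, Y⁆, f⁆ = ⁅X, ⁅Y, f⁆⁆ - ⁅Y, ⁅X, f⁆⁆ := by
  have key : ∀ W : VField E M, (⁅⁅X, Y⁆, f⁆ - (⁅X, ⁅Y, f⁆⁆ - ⁅Y, ⁅X, f⁆⁆)) • W = 0 := by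
    intro W
    have h := lie_lie X Y (f • W)
    simp only [lie_smul_fn, lie_add] at h
    rw [lie_lie] at h
    simp only [smul_sub] at h
    rw [sub_smul, sub_smul]
    have h2 := sub_eq_zero.mpr h
    rw [← h2]
    abel
  ext x
  by_cases hE : Subsingleton E
  · have : ∀ (Z : VField E M) (g : SmoothFn E M), ⁅Z, g⁆ x = 0 := fun Z g => by
      rw [lie_fn_apply]
      have : Z x = 0 := @Subsingleton.elim E hE _ _
      simp [this]
    simp [this]
  · rw [not_subsingleton_iff_nontrivial] at hE
    obtain ⟨v, hv⟩ := exists_ne (0 : E)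
    obtain ⟨W, hW⟩ := exists_apply_eq (M := M) x v
    have h := congrArg (fun Z : VField E M => Z x) (key W)
    simp only [smulFn_apply, hW] at h
    exact sub_eq_zero.mp ((smul_eq_zero.mp h).resolve_right hv)

variable [FiniteDimensional ℝ E] [T2Space M]

instance instLieRingModuleFn : LieRingModule (VField E M) (SmoothFn E M) where
  add_lie := add_lie_fn
  lie_add := lie_fn_add
  leibniz_lie X Y f := by rw [lie_lie_fn]; abel

instance instLieRinehartRing : LieRinehartRing (SmoothFn E M) (VField E M) where
  lie_smul_eq_mul' f g X := smul_lie_fn f X g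
  leibniz_mul_right' X f g := lie_fn_mul X f g
  leibniz_smul_right' X Y f := lie_smul_fn X Y f

instance instLieRinehartAlgebra : LieRinehartAlgebra ℝ (SmoothFn E M) (VField E M) where
  smul_lie c X f := by
    ext x; simp [lie_fn_apply]
  lie_smul c X f := lie_fn_smul c X f

/-- Smooth functions separate tangent vectors. -/
lemma eq_zero_of_forall_mvfderiv (x : M) (v : TangentSpace 𝓘(ℝ, E) x)
    (h : ∀ f : SmoothFn E M, mvfderiv 𝓘(ℝ, E) f x v = 0) : v = 0 := by
  have : IsManifold 𝓘(ℝ, E) 1 M := IsManifold.of_le (n := ∞) (mod_cast le_top)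
  obtain ⟨ψ⟩ : Nonempty (SmoothBumpFunction 𝓘(ℝ, E) x) := inferInstance
  have hx : x ∈ (chartAt E x).source := mem_chart_source E x
  have hφ : MDiffAt (extChartAt 𝓘(ℝ, E) x) x := mdifferentiableAt_extChartAt hx
  have hinv := isInvertible_mfderiv_extChartAt (I := 𝓘(ℝ, E)) (mem_extChartAt_source x)
  suffices h0 : mfderiv 𝓘(ℝ, E) 𝓘(ℝ, E) (extChartAt 𝓘(ℝ, E) x) x v = 0 by
    exact hinv.injective (by rw [h0, map_zero])
  refine SeparatingDual.eq_zero_of_forall_dual_eq_zero (V := E) (R := ℝ) fun ℓ => ?_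
  have hsm : CMDiff ∞ (fun y => ψ y • ℓ (extChartAt 𝓘(ℝ, E) x y)) :=
    ψ.contMDiff_smul (ℓ.contMDiff.comp_contMDiffOn contMDiffOn_extChartAt)
  have h1 := h ⟨_, hsm⟩
  have heq : (fun y => ψ y • ℓ (extChartAt 𝓘(ℝ, E) x y)) =ᶠ[nhds x]
      (ℓ ∘ extChartAt 𝓘(ℝ, E) x) := by
    filter_upwards [ψ.eventuallyEq_one] with y hy
    simp [hy]
  have h2 : mfderiv 𝓘(ℝ, E) 𝓘(ℝ, ℝ) (fun y => ψ y • ℓ (extChartAt 𝓘(ℝ, E) x y)) x v = 0 := h1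
  rw [heq.mfderiv_eq, mfderiv_comp x ℓ.mdifferentiableAt hφ, ℓ.mfderiv_eq] at h2
  exact h2
end VField

end VF

section CE

/-- The alternating `A`-multilinear maps of `n` arguments in `L`, with values in `N`. -/
abbrev Cochain (A L N : Type*) [CommRing A] [AddCommGroup L] [Module A L] [AddCommGroup N]
    [Module A N] (n : ℕ) := L [⋀^Fin n]→ₗ[A] N

/-- The alternating `A`-multilinear forms of `n` arguments in `L`. -/
abbrev CEForm (A L : Type*) [CommRing A] [AddCommGroup L] [Module A L] (n : ℕ) := Cochain A L A n

/-- An alternating `A`-multilinear map, viewed as an `ℝ`-multilinear map. -/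
def AlternatingMap.restrictReal {A V N ι : Type*} [CommRing A] [Algebra ℝ A] [AddCommGroup V]
    [Module A V] [Module ℝ V] [IsScalarTower ℝ A V] [AddCommGroup N] [Module A N] [Module ℝ N]
    [IsScalarTower ℝ A N] (θ : V [⋀^ι]→ₗ[A] N) : V [⋀^ι]→ₗ[ℝ] N :=
  { θ.toMultilinearMap.restrictScalars ℝ with map_eq_zero_of_eq' := θ.map_eq_zero_of_eq' }

lemma two_zsmul_inj {N : Type*} [AddCommGroup N] [Module ℝ N] {x y : N}
    (h : (2 : ℤ) • x = (2 : ℤ) • y) : x = y := by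
  rw [← Int.cast_smul_eq_zsmul ℝ, ← Int.cast_smul_eq_zsmul ℝ] at h
  exact smul_right_injective N (by norm_num) h

section PairSum

variable {R V N : Type*} [CommRing R] [AddCommGroup V] [Module R V] [AddCommGroup N] [Module R N]
  {n : ℕ}

/-- `∑_{a < b} (-1)^(a + b) f(v_a, v_b)(v₀, …, v̂_a, …, v̂_b, …)`; the summation indices are `a = i`
and `b = j + 1` with `i ≤ j`. -/
def pairSumFun (f : V → V → V [⋀^Fin n]→ₗ[R] N) (v : Fin (n + 2) → V) : N :=
  ∑ i : Fin (n + 1), ∑ j ∈ Finset.Ici i,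
    (-1 : ℤ) ^ ((i : ℕ) + (j : ℕ) + 1) •
      f (v i.castSucc) (v j.succ) (j.removeNth (i.castSucc.removeNth v))

lemma two_smul_pairSumFun (f : V →ₗ[R] V →ₗ[R] V [⋀^Fin n]→ₗ[R] N)
    (hf : ∀ x y, f x y = -f y x) (v : Fin (n + 2) → V) :
    (2 : ℤ) • pairSumFun (fun x y => f x y) v = - AlternatingMap.alternatizeUncurryFin
      (AlternatingMap.alternatizeUncurryFinLM ∘ₗ f) v := by
  rw [AlternatingMap.alternatizeUncurryFin_alternatizeUncurryFinLM_comp_apply, pairSumFun,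
    Finset.smul_sum, ← Finset.sum_neg_distrib]
  refine Finset.sum_congr rfl fun i _ => ?_
  rw [Finset.smul_sum, ← Finset.sum_neg_distrib]
  refine Finset.sum_congr rfl fun j _ => ?_
  rw [hf (v j.succ) (v i.castSucc), AlternatingMap.neg_apply, sub_neg_eq_add, ← two_smul ℤ,
    smul_comm, pow_succ]
  simp

variable [Module ℝ N]

/-- The sum `pairSumFun`, as an alternating map. -/
def pairSum (f : V →ₗ[R] V →ₗ[R] V [⋀^Fin n]→ₗ[R] N) (hf : ∀ x y, f x y = -f y x) :
    V [⋀^Fin (n + 2)]→ₗ[R] N where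
  toFun := pairSumFun fun x y => f x y
  map_update_add' v i x y := by
    refine two_zsmul_inj ?_
    simp only [smul_add, two_smul_pairSumFun f hf, AlternatingMap.map_update_add]
    abel
  map_update_smul' v i c x := by
    refine two_zsmul_inj ?_
    simp only [smul_comm (2 : ℤ) c, two_smul_pairSumFun f hf, AlternatingMap.map_update_smul,
      smul_neg]
  map_eq_zero_of_eq' v i j h hij := by
    refine two_zsmul_inj ?_
    simp only [two_smul_pairSumFun f hf, AlternatingMap.map_eq_zero_of_eq _ v h hij, neg_zero,
      smul_zero]

end PairSum

variable {A L N : Type*} [CommRing A] [Algebra ℝ A] [LieRing L] [LieAlgebra ℝ L] [Module A L]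
  [LieRingModule L A] [LieRinehartRing A L] [LieRinehartAlgebra ℝ A L]
  [AddCommGroup N] [Module A N] [Module ℝ N] [IsScalarTower ℝ A N]

variable (A L N) in
/-- A covariant derivative along the Lie-Rinehart algebra `L` on the `A`-module `N`. -/
structure LConn where
  /-- The derivative along an element of `L`. -/
  toFun : L → N →ₗ[ℝ] N
  map_add' : ∀ x y n, toFun (x + y) n = toFun x n + toFun y n
  map_smul' : ∀ (a : A) x n, toFun (a • x) n = a • toFun x n
  leibniz' : ∀ x (a : A) n, toFun x (a • n) = a • toFun x n + ⁅x, a⁆ • n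

variable {p : ℕ}

/-- `∑_{i < j} (-1)^(i + j) θ([v_i, v_j], v₀, …, v̂_i, …, v̂_j, …)`. -/
def bracketSum : {p : ℕ} → (L [⋀^Fin p]→ₗ[A] N) → (Fin (p + 1) → L) → N
  | 0, _, _ => 0
  | _ + 1, θ, v => pairSumFun (fun x y => θ.curryLeft ⁅x, y⁆) v

/-- `∑_i (-1)^i D_{v_i} (θ(v₀, …, v̂_i, …))` for real multilinear maps. -/
def derSumReal (D : LConn A L N) (θ : L [⋀^Fin p]→ₗ[ℝ] N) : L [⋀^Fin (p + 1)]→ₗ[ℝ] N :=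
  AlternatingMap.alternatizeUncurryFin
    { toFun := fun x => (D.toFun x).compAlternatingMap θ
      map_add' := fun x y => by ext w; exact D.map_add' x y _
      map_smul' := fun c x => by
        ext w
        have := D.map_smul' (algebraMap ℝ A c) x (θ w)
        simpa using this }

/-- `(x, y) ↦ θ([x, y], …)` -/
def bracketPair {n : ℕ} (θ : L [⋀^Fin (n + 1)]→ₗ[ℝ] N) :
    L →ₗ[ℝ] L →ₗ[ℝ] L [⋀^Fin n]→ₗ[ℝ] N :=
  LinearMap.mk₂ ℝ (fun x y => θ.curryLeft ⁅x, y⁆) (by simp) (by simp) (by simp) (by simp)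

@[simp] lemma bracketPair_apply {n : ℕ} (θ : L [⋀^Fin (n + 1)]→ₗ[ℝ] N) (x y : L) :
  bracketPair θ x y = θ.curryLeft ⁅x, y⁆ := rfl

lemma bracketPair_swap {n : ℕ} (θ : L [⋀^Fin (n + 1)]→ₗ[ℝ] N) (x y : L) :
  bracketPair θ x y = -bracketPair θ y x := by
  rw [bracketPair_apply, bracketPair_apply, ← lie_skew, map_neg]

/-- `bracketSum` for real multilinear maps. -/
def bracketSumReal :
    {p : ℕ} → (L [⋀^Fin p]→ₗ[ℝ] N) → (L [⋀^Fin (p + 1)]→ₗ[ℝ] N)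
  | 0, _ => 0
  | _ + 1, θ => pairSum (bracketPair θ) (bracketPair_swap θ)

lemma bracketSumReal_apply (θ : L [⋀^Fin p]→ₗ[A] N) (v : Fin (p + 1) → L) :
    bracketSumReal θ.restrictReal v = bracketSum θ v := by
  cases p with
  | zero => rfl
  | succ n => rfl

/-- The Koszul formula `∑_i (-1)^i D_{v_i} (θ(v₀, …, v̂_i, …)) +
∑_{i < j} (-1)^(i + j) θ([v_i, v_j], v₀, …, v̂_i, …, v̂_j, …)`. -/
def koszulFun (D : LConn A L N) (θ : L [⋀^Fin p]→ₗ[A] N) (v : Fin (p + 1) → L) : N :=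
  ∑ i : Fin (p + 1), (-1 : ℤ) ^ (i : ℕ) • D.toFun (v i) (θ (i.removeNth v)) + bracketSum θ v

lemma koszulFun_eq (D : LConn A L N) (θ : L [⋀^Fin p]→ₗ[A] N)
    (v : Fin (p + 1) → L) :
    koszulFun D θ v = (derSumReal D θ.restrictReal + bracketSumReal θ.restrictReal) v := by
  rw [AlternatingMap.add_apply, bracketSumReal_apply, koszulFun, derSumReal,
    AlternatingMap.alternatizeUncurryFin_apply]
  congr 1

lemma removeNth_succ_cons {n : ℕ} (i : Fin (n + 1)) (y : L) (w : Fin (n + 1) → L) :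
    i.succ.removeNth (Fin.cons y w : Fin (n + 2) → L) = Fin.cons y (i.removeNth w) := by
  ext k
  refine Fin.cases ?_ (fun k => ?_) k <;> simp [Fin.removeNth_apply]

lemma exists_removeNth_cons {n : ℕ} (i : Fin n) (j : Fin (n + 1)) (hij : i.succ ≤ j)
    (w : Fin (n + 1) → L) : ∃ g : L →ₗ[A] (L [⋀^Fin n]→ₗ[A] N) →ₗ[A] N, ∀ y θ,
      θ (j.removeNth (i.succ.castSucc.removeNth (Fin.cons y w : Fin (n + 2) → L))) = g y θ := by
  obtain ⟨j, rfl⟩ := Fin.exists_succ_eq.mpr ((Fin.succ_pos i).trans_le hij).ne'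
  obtain ⟨m, rfl⟩ : ∃ m, n = m + 1 := ⟨n - 1, by have := i.pos; omega⟩
  refine ⟨LinearMap.mk₂ A (fun y θ => θ.curryLeft y (j.removeNth (i.castSucc.removeNth w)))
    (by simp) (by simp) (by simp) (by simp), fun y θ => ?_⟩
  rw [← Fin.succ_castSucc, removeNth_succ_cons, removeNth_succ_cons]
  rfl

lemma koszulFun_cons_smul (D : LConn A L N) (θ : L [⋀^Fin p]→ₗ[A] N)
    (a : A) (x : L) (w : Fin p → L) :
    koszulFun D θ (Fin.cons (a • x) w : Fin (p + 1) → L) =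
      a • koszulFun D θ (Fin.cons x w : Fin (p + 1) → L) := by
  cases p with
  | zero => simp [koszulFun, bracketSum, D.map_smul']
  | succ n =>
    have hlin : ∀ (y : L) (u : Fin n → L), θ (Fin.cons y u : Fin (n + 1) → L) = θ.curryLeft y u :=
      fun _ _ => rfl
    have hbr : ∀ y : L, ⁅a • x, y⁆ = a • ⁅x, y⁆ - ⁅y, a⁆ • x := fun y => by
      rw [← lie_skew, LieRinehartRing.leibniz_smul_right, ← lie_skew x y, smul_neg]
      abel
    have hin : ∀ i : Fin n, ∀ j ∈ Finset.Ici i.succ, ∀ z : L,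
        θ.curryLeft z (j.removeNth (i.succ.castSucc.removeNth
          (Fin.cons (a • x) w : Fin (n + 2) → L))) =
        a • θ.curryLeft z (j.removeNth (i.succ.castSucc.removeNth
          (Fin.cons x w : Fin (n + 2) → L))) := by
      intro i j hij z
      obtain ⟨g, hg⟩ := exists_removeNth_cons (A := A) (N := N) i j (Finset.mem_Ici.mp hij) w
      rw [hg, hg, map_smul, LinearMap.smul_apply]
    have h0 : ∀ y, (0 : Fin (n + 2)).removeNth (Fin.cons y w : Fin (n + 2) → L) = w :=
      fun y => by ext k; simp [Fin.removeNth_apply]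
    have hIci : Finset.Ici (0 : Fin (n + 1)) = Finset.univ := by ext; simp
    have e : ∀ y : L, koszulFun D θ (Fin.cons y w : Fin (n + 2) → L) =
        D.toFun y (θ w)
        + ∑ i : Fin (n + 1), (-1 : ℤ) ^ ((i : ℕ) + 1) •
            D.toFun (w i) (θ.curryLeft y (i.removeNth w))
        + (∑ j : Fin (n + 1), (-1 : ℤ) ^ ((j : ℕ) + 1) • θ.curryLeft ⁅y, w j⁆ (j.removeNth w)
        + ∑ i : Fin n, ∑ j ∈ Finset.Ici i.succ, (-1 : ℤ) ^ ((i : ℕ) + 1 + (j : ℕ) + 1) •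
            θ.curryLeft ⁅w i.castSucc, w j⁆ (j.removeNth (i.succ.castSucc.removeNth
              (Fin.cons y w : Fin (n + 2) → L)))) := by
      intro y
      simp only [koszulFun, bracketSum, pairSumFun]
      congr 1
      · rw [Fin.sum_univ_succ]
        simp only [Fin.cons_zero, Fin.cons_succ, removeNth_succ_cons, hlin, Fin.val_zero,
          Fin.val_succ, pow_zero, one_smul, h0]
      · rw [Fin.sum_univ_succ]
        simp only [Fin.cons_succ, hIci, Fin.val_zero, Fin.val_succ, zero_add, ← Fin.succ_castSucc,
          Fin.castSucc_zero, Fin.cons_zero, h0]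
    rw [e, e]
    have e1 : ∀ i : Fin (n + 1), (-1 : ℤ) ^ ((i : ℕ) + 1) •
            D.toFun (w i) (θ.curryLeft (a • x) (i.removeNth w)) =
          a • (-1 : ℤ) ^ ((i : ℕ) + 1) • D.toFun (w i) (θ.curryLeft x (i.removeNth w)) +
          (-1 : ℤ) ^ ((i : ℕ) + 1) • ⁅w i, a⁆ • θ.curryLeft x (i.removeNth w) := by
      intro i
      rw [map_smul, AlternatingMap.smul_apply, D.leibniz', smul_add, smul_comm a]
    have e2 : ∀ j : Fin (n + 1), (-1 : ℤ) ^ ((j : ℕ) + 1) •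
            θ.curryLeft ⁅a • x, w j⁆ (j.removeNth w) =
          a • (-1 : ℤ) ^ ((j : ℕ) + 1) • θ.curryLeft ⁅x, w j⁆ (j.removeNth w) -
          (-1 : ℤ) ^ ((j : ℕ) + 1) • ⁅w j, a⁆ • θ.curryLeft x (j.removeNth w) := by
      intro i
      rw [hbr, map_sub, map_smul, map_smul, AlternatingMap.sub_apply, AlternatingMap.smul_apply,
        AlternatingMap.smul_apply, smul_sub, smul_comm a]
    have e3 : ∑ i : Fin n, ∑ j ∈ Finset.Ici i.succ, (-1 : ℤ) ^ ((i : ℕ) + 1 + (j : ℕ) + 1) •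
            θ.curryLeft ⁅w i.castSucc, w j⁆ (j.removeNth (i.succ.castSucc.removeNth
              (Fin.cons (a • x) w : Fin (n + 2) → L))) =
          a • ∑ i : Fin n, ∑ j ∈ Finset.Ici i.succ, (-1 : ℤ) ^ ((i : ℕ) + 1 + (j : ℕ) + 1) •
            θ.curryLeft ⁅w i.castSucc, w j⁆ (j.removeNth (i.succ.castSucc.removeNth
              (Fin.cons x w : Fin (n + 2) → L))) := by
      simp only [Finset.smul_sum]
      refine Finset.sum_congr rfl fun i _ => Finset.sum_congr rfl fun j hj => ?_
      rw [hin i j hj, smul_comm a]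
    rw [e3, Finset.sum_congr rfl fun i _ => e1 i, Finset.sum_congr rfl fun i _ => e2 i,
      Finset.sum_add_distrib, Finset.sum_sub_distrib, ← Finset.smul_sum, ← Finset.smul_sum,
      D.map_smul']
    simp only [smul_add]
    abel

/-- A real alternating map that is `A`-homogeneous in its first slot is homogeneous in each. -/
lemma AlternatingMap.smul_of_cons (θ : L [⋀^Fin (p + 1)]→ₗ[ℝ] N)
    (h : ∀ (a : A) (x : L) (w : Fin p → L),
      θ (Fin.cons (a • x) w : Fin (p + 1) → L) = a • θ (Fin.cons x w : Fin (p + 1) → L))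
    (v : Fin (p + 1) → L) (i : Fin (p + 1)) (a : A) (x : L) :
    θ (Function.update v i (a • x)) = a • θ (Function.update v i x) := by
  have key : ∀ y, θ (Function.update v i y) =
      (-1 : ℤ) ^ (i : ℕ) • θ (Fin.cons y (i.removeNth v) : Fin (p + 1) → L) := fun y => by
    rw [← Fin.insertNth_removeNth, AlternatingMap.map_insertNth]
    simp [Matrix.vecCons]
  rw [key, key, h, smul_comm]

lemma bracketSum_add (θ η : L [⋀^Fin p]→ₗ[A] N) (v : Fin (p + 1) → L) :
    bracketSum (θ + η) v = bracketSum θ v + bracketSum η v := by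
  cases p with
  | zero => simp [bracketSum]
  | succ n => simp [bracketSum, pairSumFun, Finset.sum_add_distrib]

lemma bracketSum_smul (c : A) (θ : L [⋀^Fin p]→ₗ[A] N) (v : Fin (p + 1) → L) :
    bracketSum (c • θ) v = c • bracketSum θ v := by
  cases p with
  | zero => simp [bracketSum]
  | succ n => simp [bracketSum, pairSumFun, Finset.smul_sum, smul_comm c]

lemma bracketSum_comp {N' : Type*} [AddCommGroup N'] [Module A N']
    (g : N →ₗ[A] N') (θ : L [⋀^Fin p]→ₗ[A] N) (v : Fin (p + 1) → L) :
    bracketSum (g.compAlternatingMap θ) v = g (bracketSum θ v) := by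
  cases p with
  | zero => simp [bracketSum]
  | succ n => simp [bracketSum, pairSumFun]

variable (p) in
/-- The covariant exterior derivative given by the Koszul formula. -/
def koszul (D : LConn A L N) : (L [⋀^Fin p]→ₗ[A] N) →ₗ[ℝ] (L [⋀^Fin (p + 1)]→ₗ[A] N) where
  toFun θ :=
    { toFun := koszulFun D θ
      map_update_add' := fun v i x y => by
        simp only [koszulFun_eq, AlternatingMap.map_update_add]
      map_update_smul' := fun v i c x => by
        rw [koszulFun_eq, koszulFun_eq]
        rename_i inst
        obtain rfl : inst = instDecidableEqFin _ := Subsingleton.elim _ _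
        refine AlternatingMap.smul_of_cons (A := A) _ (fun a x w => ?_) v i c x
        rw [← koszulFun_eq, ← koszulFun_eq, koszulFun_cons_smul]
      map_eq_zero_of_eq' := fun v i j h hij => by
        rw [koszulFun_eq, AlternatingMap.map_eq_zero_of_eq _ v h hij] }
  map_add' θ η := by
    ext v
    change koszulFun D (θ + η) v = koszulFun D θ v + koszulFun D η v
    simp only [koszulFun, AlternatingMap.add_apply, map_add, smul_add, bracketSum_add,
      Finset.sum_add_distrib]
    abel
  map_smul' c θ := by
    ext v
    change koszulFun D (c • θ) v = c • koszulFun D θ v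
    simp only [koszulFun, AlternatingMap.smul_apply, map_smul, smul_add, Finset.smul_sum]
    have hc : c • θ = algebraMap ℝ A c • θ := by ext; simp
    rw [hc, bracketSum_smul, algebraMap_smul]
    simp only [smul_comm c]

lemma koszul_apply (D : LConn A L N) (θ : L [⋀^Fin p]→ₗ[A] N) (v : Fin (p + 1) → L) :
    koszul p D θ v = ∑ i : Fin (p + 1), (-1 : ℤ) ^ (i : ℕ) • D.toFun (v i) (θ (i.removeNth v)) +
      bracketSum θ v := rfl

lemma koszul_comp {N' : Type*} [AddCommGroup N'] [Module A N'] [Module ℝ N'] [IsScalarTower ℝ A N']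
    (D : LConn A L N) (D' : LConn A L N') (g : N →ₗ[A] N')
    (h : ∀ x n, g (D.toFun x n) = D'.toFun x (g n)) (θ : L [⋀^Fin p]→ₗ[A] N) :
    koszul p D' (g.compAlternatingMap θ) = g.compAlternatingMap (koszul p D θ) := by
  ext v
  simp [koszul_apply, bracketSum_comp, h]

variable (A L) in
/-- The canonical action on functions. -/
def LConn.canonical : LConn A L A where
  toFun x := (LieModule.toEnd ℝ L A x)
  map_add' x y a := by simp
  map_smul' a x b := by simp
  leibniz' x a b := by simp

@[simp] lemma LConn.canonical_apply (x : L) (a : A) : (LConn.canonical A L).toFun x a = ⁅x, a⁆ := rfl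

/-- The differential on alternating forms on a Lie-Rinehart algebra. On the vector fields of a
manifold this is the de Rham differential. -/
def ceD (p : ℕ) : (L [⋀^Fin p]→ₗ[A] A) →ₗ[ℝ] (L [⋀^Fin (p + 1)]→ₗ[A] A) :=
  koszul p (LConn.canonical A L)

lemma ceD_smul_of_invariant (a : A) (ha : ∀ x : L, ⁅x, a⁆ = 0) (θ : L [⋀^Fin p]→ₗ[A] A) :
    ceD p (a • θ) = a • ceD p θ := by
  ext v
  simp [ceD, koszul_apply, bracketSum_smul, ha, Finset.mul_sum, mul_add, mul_left_comm]


section LieDeriv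

variable {V : Type*} [AddCommGroup V] [Module ℝ V] {q : ℕ}

/-- The Lie derivative formula `δ(θ(v₁, …)) - ∑_k θ(v₁, …, T v_k, …)`. -/
def lieFun (δ : N → N) (T : V → V) (θ : (Fin q → V) → N) (v : Fin q → V) : N :=
  δ (θ v) - ∑ k : Fin q, θ (Function.update v k (T (v k)))

lemma lieFun_eq_zero_of_eq {R : Type*} [CommRing R] [Module R V] [Module R N]
    (δ : N →ₗ[ℝ] N) (T : V → V) (θ : V [⋀^Fin q]→ₗ[R] N) (v : Fin q → V)
    {i j : Fin q} (h : v i = v j) (hij : i ≠ j) : lieFun δ T θ v = 0 := by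
  rw [lieFun, θ.map_eq_zero_of_eq v h hij, map_zero, zero_sub, neg_eq_zero,
    Fintype.sum_eq_add i j hij]
  · have := θ.map_swap_add (v := Function.update v i (T (v i))) hij
    rw [add_comm] at this
    rw [← this]
    congr 2
    ext k
    simp only [Function.comp_apply, Function.update_apply, Equiv.swap_apply_def]
    split_ifs <;> simp_all
  · rintro k ⟨hki, hkj⟩
    refine θ.map_eq_zero_of_eq _ (i := i) (j := j) ?_ hij
    simp [Function.update_of_ne hki.symm, Function.update_of_ne hkj.symm, h]

lemma sum_update_update {q : ℕ} (T : V → V) (θ : (Fin q → V) → N) (v : Fin q → V) (i : Fin q) (x : V) :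
    ∑ k : Fin q, θ (Function.update (Function.update v i x) k (T (Function.update v i x k))) =
      θ (Function.update v i (T x)) +
      ∑ k ∈ Finset.univ.erase i, θ (Function.update (Function.update v k (T (v k))) i x) := by
  rw [← Finset.add_sum_erase _ _ (Finset.mem_univ i)]
  congr 1
  · simp
  · refine Finset.sum_congr rfl fun k hk => ?_
    have hki := Finset.ne_of_mem_erase hk
    rw [Function.update_of_ne hki, Function.update_comm hki.symm]

/-- The Lie derivative formula on real alternating maps. -/
def lieReal (δ : N →ₗ[ℝ] N) (T : V →ₗ[ℝ] V) (θ : V [⋀^Fin q]→ₗ[ℝ] N) : V [⋀^Fin q]→ₗ[ℝ] N where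
  toFun := lieFun δ T θ
  map_update_add' v i x y := by
    rename_i inst
    obtain rfl : inst = instDecidableEqFin _ := Subsingleton.elim _ _
    simp only [lieFun, sum_update_update, map_add, AlternatingMap.map_update_add,
      Finset.sum_add_distrib]
    abel
  map_update_smul' v i c x := by
    rename_i inst
    obtain rfl : inst = instDecidableEqFin _ := Subsingleton.elim _ _
    simp only [lieFun, sum_update_update, map_smul, AlternatingMap.map_update_smul,
      ← Finset.smul_sum, smul_sub, smul_add]
  map_eq_zero_of_eq' v i j h hij := lieFun_eq_zero_of_eq δ T θ v h hij

variable [Module A V]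

/-- The Lie derivative formula on alternating `A`-multilinear maps, where `δ` and `T` are derivations
over the same derivation `σ` of `A`. -/
def lieAlt (δ : N →ₗ[ℝ] N) (T : V →ₗ[ℝ] V) (σ : A → A)
    (hδ : ∀ (a : A) n, δ (a • n) = a • δ n + σ a • n)
    (hT : ∀ (a : A) v, T (a • v) = a • T v + σ a • v) :
    (V [⋀^Fin q]→ₗ[A] N) →ₗ[ℝ] (V [⋀^Fin q]→ₗ[A] N) where
  toFun θ :=
    { toFun := lieFun δ T θ
      map_update_add' := fun v i x y => by
        rename_i inst
        obtain rfl : inst = instDecidableEqFin _ := Subsingleton.elim _ _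
        simp only [lieFun, sum_update_update, map_add, AlternatingMap.map_update_add,
          Finset.sum_add_distrib]
        abel
      map_update_smul' := fun v i c x => by
        rename_i inst
        obtain rfl : inst = instDecidableEqFin _ := Subsingleton.elim _ _
        simp only [lieFun, sum_update_update, hδ, hT, AlternatingMap.map_update_add,
          AlternatingMap.map_update_smul, ← Finset.smul_sum, smul_sub, smul_add]
        abel
      map_eq_zero_of_eq' := fun v i j h hij => lieFun_eq_zero_of_eq δ T θ v h hij }
  map_add' θ η := by
    ext v
    change lieFun δ T (θ + η) v = lieFun δ T θ v + lieFun δ T η v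
    simp [lieFun, Finset.sum_add_distrib]
    abel
  map_smul' c θ := by
    ext v
    change lieFun δ T (c • θ) v = c • lieFun δ T θ v
    simp [lieFun, Finset.smul_sum, smul_sub]

end LieDeriv

section Commute

variable {q : ℕ} {V : Type*} [AddCommGroup V] [Module ℝ V]

lemma lieReal_apply (δ : N →ₗ[ℝ] N) (T : V →ₗ[ℝ] V) (θ : V [⋀^Fin q]→ₗ[ℝ] N) (v : Fin q → V) :
    lieReal δ T θ v = δ (θ v) - ∑ k : Fin q, θ (Function.update v k (T (v k))) := rfl

lemma lieReal_alternatize (δ : N →ₗ[ℝ] N) (T : V →ₗ[ℝ] V)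
    (f g : V →ₗ[ℝ] V [⋀^Fin q]→ₗ[ℝ] N) (h : ∀ x, g x = lieReal δ T (f x) - f (T x)) :
    lieReal δ T (AlternatingMap.alternatizeUncurryFin f) =
      AlternatingMap.alternatizeUncurryFin g := by
  ext v
  simp only [lieReal_apply, AlternatingMap.alternatizeUncurryFin_apply, map_sum, map_zsmul]
  rw [Finset.sum_comm, ← Finset.sum_sub_distrib]
  refine Finset.sum_congr rfl fun i _ => ?_
  rw [Fin.sum_univ_succAbove _ i, h, ← Finset.smul_sum]
  simp only [Function.update_self, Fin.removeNth_update, ne_eq, (Fin.succAbove_ne i _).symm,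
    not_false_eq_true, Function.update_of_ne, Fin.removeNth_update_succAbove,
    AlternatingMap.sub_apply, lieReal_apply, smul_sub]
  simp only [Fin.removeNth_apply]
  abel

lemma lieReal_add (δ : N →ₗ[ℝ] N) (T : V →ₗ[ℝ] V) (θ η : V [⋀^Fin q]→ₗ[ℝ] N) :
    lieReal δ T (θ + η) = lieReal δ T θ + lieReal δ T η := by
  ext v
  simp [lieReal_apply, Finset.sum_add_distrib]
  abel

lemma lieReal_neg (δ : N →ₗ[ℝ] N) (T : V →ₗ[ℝ] V) (θ : V [⋀^Fin q]→ₗ[ℝ] N) :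
    lieReal δ T (-θ) = -lieReal δ T θ := by
  ext v
  simp [lieReal_apply, sub_eq_add_neg, add_comm]

lemma lieReal_smul (δ : N →ₗ[ℝ] N) (T : V →ₗ[ℝ] V) (c : ℤ) (θ : V [⋀^Fin q]→ₗ[ℝ] N) :
    lieReal δ T (c • θ) = c • lieReal δ T θ := by
  ext v
  simp [lieReal_apply, Finset.smul_sum, smul_sub]

lemma lieReal_curryLeft (δ : N →ₗ[ℝ] N) (T : V →ₗ[ℝ] V) (θ : V [⋀^Fin (q + 1)]→ₗ[ℝ] N) (x : V) :
    (lieReal δ T θ).curryLeft x = lieReal δ T (θ.curryLeft x) - θ.curryLeft (T x) := by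
  ext v
  simp only [AlternatingMap.curryLeft_apply_apply, lieReal_apply, Fin.sum_univ_succ,
    AlternatingMap.sub_apply]
  simp only [Matrix.vecCons, Fin.cons_update, Fin.update_cons_zero, Fin.cons_zero, Fin.cons_succ]
  abel

variable (δ : N →ₗ[ℝ] N) (T : L →ₗ[ℝ] L)

lemma lieReal_bracketSum (hT : ∀ x y, T ⁅x, y⁆ = ⁅T x, y⁆ + ⁅x, T y⁆)
    (θ : L [⋀^Fin p]→ₗ[ℝ] N) :
    lieReal δ T (bracketSumReal θ) = bracketSumReal (lieReal δ T θ) := by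
  cases p with
  | zero => ext v; simp [bracketSumReal, lieReal_apply]
  | succ n =>
    have h2 : ∀ η : L [⋀^Fin (n + 1)]→ₗ[ℝ] N, (2 : ℤ) • bracketSumReal η =
        -AlternatingMap.alternatizeUncurryFin
          (AlternatingMap.alternatizeUncurryFinLM ∘ₗ bracketPair η) := fun η => by
      ext v
      exact two_smul_pairSumFun (bracketPair η) (bracketPair_swap η) v
    refine two_zsmul_inj ?_
    rw [← lieReal_smul, h2, h2, lieReal_neg]
    congr 1
    refine lieReal_alternatize δ T _ _ fun x => ?_
    simp only [LinearMap.comp_apply, AlternatingMap.alternatizeUncurryFinLM_apply]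
    rw [lieReal_alternatize δ T (bracketPair θ x) (bracketPair (lieReal δ T θ) x +
      bracketPair θ (T x)) fun y => ?_, AlternatingMap.alternatizeUncurryFin_add, add_sub_cancel_right]
    simp only [LinearMap.add_apply, bracketPair_apply, lieReal_curryLeft, hT, map_add]
    abel

lemma lieReal_derSum (D : LConn A L N) (hD : ∀ x n, δ (D.toFun x n) = D.toFun x (δ n) + D.toFun (T x) n)
    (θ : L [⋀^Fin p]→ₗ[ℝ] N) :
    lieReal δ T (derSumReal D θ) = derSumReal D (lieReal δ T θ) := by
  refine lieReal_alternatize δ T _ _ fun x => ?_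
  ext v
  simp [lieReal_apply, hD]
  abel

lemma koszul_lieAlt (hT : ∀ x y, T ⁅x, y⁆ = ⁅T x, y⁆ + ⁅x, T y⁆)
    (D : LConn A L N)
    (hD : ∀ x n, δ (D.toFun x n) = D.toFun x (δ n) + D.toFun (T x) n) (σ : A → A)
    (h1 : ∀ (a : A) n, δ (a • n) = a • δ n + σ a • n)
    (h2 : ∀ (a : A) v, T (a • v) = a • T v + σ a • v) (θ : L [⋀^Fin p]→ₗ[A] N) :
    koszul p D (lieAlt δ T σ h1 h2 θ) = lieAlt δ T σ h1 h2 (koszul p D θ) := by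
  ext v
  have hk : ∀ η : L [⋀^Fin p]→ₗ[A] N, (koszul p D η).restrictReal =
      derSumReal D η.restrictReal + bracketSumReal η.restrictReal := fun η => by
    ext w; exact koszulFun_eq D η w
  have hl : ∀ {q : ℕ} (η : L [⋀^Fin q]→ₗ[A] N), (lieAlt δ T σ h1 h2 η).restrictReal =
      lieReal δ T η.restrictReal := fun η => rfl
  suffices h : (koszul p D (lieAlt δ T σ h1 h2 θ)).restrictReal =
      (lieAlt δ T σ h1 h2 (koszul p D θ)).restrictReal from congrArg (fun η => η v) h
  rw [hl, hk, hk, hl, lieReal_add, lieReal_derSum δ T D hD, lieReal_bracketSum δ T hT]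

end Commute

end CE

section Fibration

variable {E F M B : Type*} [NormedAddCommGroup E] [NormedSpace ℝ E] [FiniteDimensional ℝ E]
  [NormedAddCommGroup F] [NormedSpace ℝ F] [FiniteDimensional ℝ F]
  [TopologicalSpace M] [ChartedSpace E M] [IsManifold 𝓘(ℝ, E) ∞ M] [T2Space M]
  [TopologicalSpace B] [ChartedSpace F B] [IsManifold 𝓘(ℝ, F) ∞ B] [T2Space B]

/-- The pullback `p^* f = f ∘ p` of functions on the base. -/
def pullbackFn (p : C^∞⟮𝓘(ℝ, E), M; 𝓘(ℝ, F), B⟯) : SmoothFn F B →ₐ[ℝ] SmoothFn E M where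
  toFun f := f.comp p
  map_one' := rfl
  map_mul' _ _ := rfl
  map_zero' := rfl
  map_add' _ _ := rfl
  commutes' _ := rfl

variable (p : C^∞⟮𝓘(ℝ, E), M; 𝓘(ℝ, F), B⟯)

@[simp] lemma pullbackFn_apply (f : SmoothFn F B) (x : M) : pullbackFn p f x = f (p x) := rfl

lemma lie_pullbackFn_apply (X : VField E M) (f : SmoothFn F B) (x : M) :
    ⁅X, pullbackFn p f⁆ x =
      mvfderiv 𝓘(ℝ, F) f (p x) (mfderiv 𝓘(ℝ, E) 𝓘(ℝ, F) p x (X x)) := by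
  have h := mfderiv_comp x (I := 𝓘(ℝ, E)) (I' := 𝓘(ℝ, F)) (I'' := 𝓘(ℝ, ℝ)) (g := f) (f := p)
    f.mdifferentiableAt p.mdifferentiableAt
  have h2 : mfderiv 𝓘(ℝ, E) 𝓘(ℝ, ℝ) (f ∘ p) x (X x) =
      mfderiv 𝓘(ℝ, F) 𝓘(ℝ, ℝ) f (p x) (mfderiv 𝓘(ℝ, E) 𝓘(ℝ, F) p x (X x)) := by
    rw [h]; rfl
  exact h2

lemma vertical_iff (X : VField E M) :
    (∀ x, mfderiv 𝓘(ℝ, E) 𝓘(ℝ, F) p x (X x) = 0) ↔ ∀ f : SmoothFn F B, ⁅X, pullbackFn p f⁆ = 0 := by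
  constructor
  · intro h f
    ext x
    rw [lie_pullbackFn_apply, h x, map_zero]
    rfl
  · intro h x
    refine VField.eq_zero_of_forall_mvfderiv (p x) _ fun f => ?_
    rw [← lie_pullbackFn_apply, h f]
    rfl

/-- The vertical vector fields, the sections of `Ver = ker dp`. -/
def Ver : LieRinehartSubalgebra (SmoothFn E M) (VField E M) where
  carrier := {X | ∀ x, mfderiv 𝓘(ℝ, E) 𝓘(ℝ, F) p x (X x) = 0}
  add_mem' {X Y} hX hY x := by
    rw [ContMDiffSection.coe_add, Pi.add_apply, map_add, hX x, hY x, add_zero]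
  zero_mem' x := map_zero _
  smul_mem' f X hX x := by
    rw [VField.smulFn_apply, map_smul, hX x, smul_zero]
  lie_mem' {X Y} hX hY := by
    have hX' := (vertical_iff p X).mp hX
    have hY' := (vertical_iff p Y).mp hY
    exact (vertical_iff p ⁅X, Y⁆).mpr fun f => by
      rw [VField.lie_lie_fn, hX', hY', lie_zero, lie_zero, sub_zero]

lemma mem_Ver_iff {X : VField E M} :
    X ∈ Ver p ↔ ∀ f : SmoothFn F B, ⁅X, pullbackFn p f⁆ = 0 := vertical_iff p X

/-- `Ω^q(Ver)`: the vertical `q`-forms, or `q`-forms on the fibres, as alternating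
`C^∞(M)`-multilinear maps on vertical vector fields. -/
abbrev VForm (q : ℕ) := CEForm (SmoothFn E M) (Ver p) q

/-- Functions on the base act on vertical forms through `p^*`. -/
instance VForm.instModuleBase (q : ℕ) : Module (SmoothFn F B) (VForm p q) :=
  Module.compHom _ (pullbackFn p).toRingHom

lemma VForm.base_smul_def {q : ℕ} (f : SmoothFn F B) (η : VForm p q) :
    f • η = pullbackFn p f • η := rfl

instance VForm.instIsScalarTower (q : ℕ) : IsScalarTower ℝ (SmoothFn F B) (VForm p q) where
  smul_assoc c f η := by
    rw [VForm.base_smul_def, VForm.base_smul_def, map_smul]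
    ext v x
    simp

/-- The vertical de Rham differential `d_V`, linear over functions on the base. -/
def dVer (q : ℕ) : VForm p q →ₗ[SmoothFn F B] VForm p (q + 1) where
  toFun := ceD q
  map_add' := map_add _
  map_smul' f η := by
    exact ceD_smul_of_invariant (A := SmoothFn E M) (L := Ver p) (pullbackFn p f)
      (fun X => (mem_Ver_iff p).mp X.2 f) η

end Fibration

section Connection

variable {E F M B : Type*} [NormedAddCommGroup E] [NormedSpace ℝ E] [FiniteDimensional ℝ E]
  [NormedAddCommGroup F] [NormedSpace ℝ F] [FiniteDimensional ℝ F]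
  [TopologicalSpace M] [ChartedSpace E M] [IsManifold 𝓘(ℝ, E) ∞ M] [T2Space M]
  [TopologicalSpace B] [ChartedSpace F B] [IsManifold 𝓘(ℝ, F) ∞ B] [T2Space B]

/-- An Ehresmann connection on `p : M → B`: a complement `Hor` of `Ver = ker dp` in `TM`, depending
smoothly on the point. Smoothness is expressed by the existence of smooth horizontal lifts of smooth
vector fields on the base; the lifts of a local frame of `TB` form a local frame of `Hor`. -/
structure EhresmannConnection (p : C^∞⟮𝓘(ℝ, E), M; 𝓘(ℝ, F), B⟯) where
  /-- The horizontal space at a point. -/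
  hor : ∀ x : M, Submodule ℝ (TangentSpace 𝓘(ℝ, E) x)
  isCompl_hor : ∀ x,
    IsCompl (LinearMap.ker (mfderiv 𝓘(ℝ, E) 𝓘(ℝ, F) p x).toLinearMap) (hor x)
  exists_lift : ∀ u : VField F B, ∃ X : VField E M, ∀ x,
    X x ∈ hor x ∧ mfderiv 𝓘(ℝ, E) 𝓘(ℝ, F) p x (X x) = u (p x)

variable {p : C^∞⟮𝓘(ℝ, E), M; 𝓘(ℝ, F), B⟯}

namespace EhresmannConnection

variable (h : EhresmannConnection p)

/-- The connection is complete: along every smooth path in the base, parallel transport starting at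
any point over the initial point is defined for all times. -/
def IsComplete : Prop :=
  ∀ (γ : ℝ → B), ContMDiff 𝓘(ℝ, ℝ) 𝓘(ℝ, F) ∞ γ → ∀ x : M, p x = γ 0 →
    ∃ c : ℝ → M, ContMDiff 𝓘(ℝ, ℝ) 𝓘(ℝ, E) ∞ c ∧ c 0 = x ∧ (∀ t, p (c t) = γ t) ∧
      ∀ t, mfderiv 𝓘(ℝ, ℝ) 𝓘(ℝ, E) c t (1 : ℝ) ∈ h.hor (c t)

/-- The horizontal lift `h(u)` of a vector field `u` on the base: the unique horizontal vector field
that projects to `u`. -/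
def lift (u : VField F B) : VField E M := (h.exists_lift u).choose

lemma lift_mem (u : VField F B) (x : M) : h.lift u x ∈ h.hor x :=
  ((h.exists_lift u).choose_spec x).1

lemma mfderiv_lift (u : VField F B) (x : M) :
    mfderiv 𝓘(ℝ, E) 𝓘(ℝ, F) p x (h.lift u x) = u (p x) :=
  ((h.exists_lift u).choose_spec x).2

lemma lift_unique {u : VField F B} {X : VField E M} (hX : ∀ x, X x ∈ h.hor x)
    (hu : ∀ x, mfderiv 𝓘(ℝ, E) 𝓘(ℝ, F) p x (X x) = u (p x)) : h.lift u = X := by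
  ext x
  rw [← sub_eq_zero]
  refine Submodule.disjoint_def.mp (h.isCompl_hor x).disjoint _ ?_
    (sub_mem (h.lift_mem u x) (hX x))
  change mfderiv 𝓘(ℝ, E) 𝓘(ℝ, F) p x (h.lift u x - X x) = 0
  rw [map_sub, h.mfderiv_lift, hu, sub_self]

lemma lift_add (u v : VField F B) : h.lift (u + v) = h.lift u + h.lift v := by
  refine h.lift_unique (fun x => ?_) (fun x => ?_)
  · exact add_mem (h.lift_mem u x) (h.lift_mem v x)
  · rw [ContMDiffSection.coe_add, Pi.add_apply, map_add, mfderiv_lift, mfderiv_lift]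
    rfl

lemma lift_smul (f : SmoothFn F B) (u : VField F B) :
    h.lift (f • u) = pullbackFn p f • h.lift u := by
  refine h.lift_unique (fun x => ?_) (fun x => ?_)
  · exact Submodule.smul_mem _ _ (h.lift_mem u x)
  · rw [VField.smulFn_apply, map_smul, mfderiv_lift]
    rfl

lemma lie_lift_pullbackFn (u : VField F B) (f : SmoothFn F B) :
    ⁅h.lift u, pullbackFn p f⁆ = pullbackFn p ⁅u, f⁆ := by
  ext x
  rw [lie_pullbackFn_apply, mfderiv_lift]
  rfl

/-- Bracketing with a horizontal lift preserves vertical vector fields. -/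
lemma lie_lift_mem (u : VField F B) (X : Ver p) : ⁅h.lift u, (X : VField E M)⁆ ∈ Ver p := by
  rw [mem_Ver_iff]
  intro f
  rw [VField.lie_lie_fn, (mem_Ver_iff p).mp X.2, lie_lift_pullbackFn, (mem_Ver_iff p).mp X.2,
    lie_zero, sub_zero]

/-- The action `X ↦ [h(u), X]` of a vector field on the base on vertical vector fields. -/
def adVer (u : VField F B) : Ver p →ₗ[ℝ] Ver p where
  toFun X := ⟨⁅h.lift u, (X : VField E M)⁆, h.lie_lift_mem u X⟩
  map_add' X Y := Subtype.ext (lie_add (h.lift u) (X : VField E M) Y)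
  map_smul' c X := Subtype.ext (lie_smul c (h.lift u) (X : VField E M))

lemma coe_adVer (u : VField F B) (X : Ver p) :
    (h.adVer u X : VField E M) = ⁅h.lift u, (X : VField E M)⁆ := rfl

lemma adVer_smul (u : VField F B) (g : SmoothFn E M) (X : Ver p) :
    h.adVer u (g • X) = g • h.adVer u X + ⁅h.lift u, g⁆ • X :=
  Subtype.ext (VField.lie_smul_fn (h.lift u) (X : VField E M) g)

/-- The Lie derivative of a vertical form along the horizontal lift of `u`:
`(L_{h(u)} η)(X₁, …) = h(u) (η(X₁, …)) - ∑ₖ η(X₁, …, [h(u), Xₖ], …)`. -/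
def lieHor {q : ℕ} (u : VField F B) : VForm p q →ₗ[ℝ] VForm p q :=
  lieAlt (LieModule.toEnd ℝ (VField E M) (SmoothFn E M) (h.lift u)) (h.adVer u)
    (fun g => ⁅h.lift u, g⁆) (fun f g => VField.lie_fn_mul (h.lift u) f g) (h.adVer_smul u)

lemma lieHor_apply {q : ℕ} (u : VField F B) (η : VForm p q) (X : Fin q → Ver p) :
    h.lieHor u η X = ⁅h.lift u, η X⁆ - ∑ k, η (Function.update X k (h.adVer u (X k))) := rfl

variable (q : ℕ)

/-- The Lie derivatives along horizontal lifts form a covariant derivative on vertical forms. -/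
def conn : LConn (SmoothFn F B) (VField F B) (VForm p q) where
  toFun u := h.lieHor u
  map_add' u v η := by
    ext X : 1
    have : ∀ Y : Ver p, h.adVer (u + v) Y = h.adVer u Y + h.adVer v Y := fun Y =>
      Subtype.ext (by simp only [coe_adVer, lift_add, add_lie]; rfl)
    simp only [AlternatingMap.add_apply, lieHor_apply, lift_add, add_lie, this,
      AlternatingMap.map_update_add, Finset.sum_add_distrib]
    abel
  map_smul' f u η := by
    ext X : 1
    have : ∀ Y : Ver p, h.adVer (f • u) Y = pullbackFn p f • h.adVer u Y := fun Y =>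
      Subtype.ext <| by
        simp only [coe_adVer, lift_smul]
        change _ = pullbackFn p f • ⁅h.lift u, (Y : VField E M)⁆
        rw [← lie_skew, VField.lie_smul_fn, (mem_Ver_iff p).mp Y.2, zero_smul, add_zero,
          ← lie_skew (Y : VField E M), smul_neg, neg_neg]
    rw [VForm.base_smul_def]
    simp only [AlternatingMap.smul_apply, lieHor_apply, lift_smul, this, VField.smul_lie_fn,
      AlternatingMap.map_update_smul, mul_sub, Finset.mul_sum, smul_eq_mul]
  leibniz' u f η := by
    ext X : 1
    rw [VForm.base_smul_def, VForm.base_smul_def, VForm.base_smul_def]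
    simp only [AlternatingMap.smul_apply, AlternatingMap.add_apply, lieHor_apply, smul_eq_mul,
      VField.lie_fn_mul, lie_lift_pullbackFn, mul_sub, Finset.mul_sum]
    abel

end EhresmannConnection

variable (p) in
/-- `Ω^a(B, Ω^q(Ver))`: the `a`-forms on the base with values in the `q`-forms on the fibres, as
alternating `C^∞(B)`-multilinear maps on the vector fields on the base. -/
abbrev BForm (a q : ℕ) := Cochain (SmoothFn F B) (VField F B) (VForm p q) a

instance (priority := 2000) BForm.instAddCommGroup (a q : ℕ) : AddCommGroup (BForm p a q) :=
  AlternatingMap.instAddCommGroup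

instance (priority := 2000) BForm.instAddCommMonoid (a q : ℕ) : AddCommMonoid (BForm p a q) :=
  (BForm.instAddCommGroup a q).toAddCommMonoid

instance (priority := 2000) BForm.instModuleReal (a q : ℕ) : Module ℝ (BForm p a q) :=
  AlternatingMap.instModule

variable (p) in
/-- `Ω^q(Ver) = Ω^0(B, Ω^q(Ver))`. -/
def BForm.ofVForm {q : ℕ} (η : VForm p q) : BForm p 0 q :=
  AlternatingMap.constOfIsEmpty (SmoothFn F B) (VField F B) (Fin 0) η

variable (p) in
/-- `d^V Θ = (-1)^a d_V ∘ Θ`. -/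
def dV (a q : ℕ) : BForm p a q →ₗ[ℝ] BForm p a (q + 1) :=
  (-1 : ℤ) ^ a •
    { toFun := fun Θ => (dVer p q).compAlternatingMap Θ
      map_add' := fun Θ Λ => by ext; simp
      map_smul' := fun c Θ => by
        ext v : 1
        exact (ceD q).map_smul c (Θ v) }

lemma dV_apply {a q : ℕ} (Θ : BForm p a q) (v : Fin a → VField F B) :
    dV p a q Θ v = (-1 : ℤ) ^ a • dVer p q (Θ v) := rfl

namespace EhresmannConnection

variable (h : EhresmannConnection p)

/-- The covariant exterior derivative `d^H`: the Koszul formula with the Lie derivatives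
`L_{h(v_i)}`. -/
def dH (a q : ℕ) : BForm p a q →ₗ[ℝ] BForm p (a + 1) q := koszul a (h.conn q)

lemma dVer_lieHor (q : ℕ) (u : VField F B) (η : VForm p q) :
    dVer p q (h.lieHor u η) = h.lieHor u (dVer p q η) := by
  refine koszul_lieAlt (A := SmoothFn E M) (L := Ver p)
    (LieModule.toEnd ℝ (VField E M) (SmoothFn E M) (h.lift u)) (h.adVer u) (fun X Y => ?_)
    (LConn.canonical (SmoothFn E M) (Ver p)) (fun X g => ?_) _ _ _ η
  · exact Subtype.ext (leibniz_lie (h.lift u) (X : VField E M) (Y : VField E M))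
  · have := leibniz_lie (h.lift u) (X : VField E M) g
    rw [add_comm] at this
    exact this

lemma dV_dH (a q : ℕ) (Θ : BForm p a q) :
    dV p (a + 1) q (h.dH a q Θ) = -h.dH a (q + 1) (dV p a q Θ) := by
  have key := koszul_comp (h.conn q) (h.conn (q + 1)) (dVer p q) (h.dVer_lieHor q) Θ
  have e : ∀ (b : ℕ) (Λ : BForm p b q),
      dV p b q Λ = (-1 : ℤ) ^ b • (dVer p q).compAlternatingMap Λ := fun _ _ => rfl
  rw [e, e, map_zsmul, dH, dH, key, pow_succ, mul_neg_one, neg_smul]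

/-- The curvature `C(u, v) = [h(u), h(v)] - h([u, v])`, a vertical vector field. -/
def curvature (u v : VField F B) : Ver p :=
  ⟨⁅h.lift u, h.lift v⁆ - h.lift ⁅u, v⁆, (mem_Ver_iff p).mpr fun f => by
    rw [sub_lie, VField.lie_lie_fn]
    simp only [lie_lift_pullbackFn]
    rw [VField.lie_lie_fn, map_sub, sub_self]⟩

lemma coe_curvature (u v : VField F B) :
    (h.curvature u v : VField E M) = ⁅h.lift u, h.lift v⁆ - h.lift ⁅u, v⁆ := rfl

lemma curvature_swap (u v : VField F B) : h.curvature u v = -h.curvature v u := by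
  refine Subtype.ext ?_
  have e : h.lift (-⁅v, u⁆) = -h.lift ⁅v, u⁆ := by
    have := h.lift_smul (-1) ⁅v, u⁆
    simpa using this
  rw [coe_curvature, ← lie_skew, ← lie_skew u v, e]
  change _ = -(⁅h.lift v, h.lift u⁆ - h.lift ⁅v, u⁆)
  abel

lemma curvature_add (u v w : VField F B) :
    h.curvature u (v + w) = h.curvature u v + h.curvature u w := by
  refine Subtype.ext ?_
  change _ = (⁅h.lift u, h.lift v⁆ - h.lift ⁅u, v⁆) + (⁅h.lift u, h.lift w⁆ - h.lift ⁅u, w⁆)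
  simp only [coe_curvature, lift_add, lie_add]
  abel

lemma curvature_smul (f : SmoothFn F B) (u v : VField F B) :
    h.curvature u (f • v) = pullbackFn p f • h.curvature u v := by
  refine Subtype.ext ?_
  change _ = pullbackFn p f • (⁅h.lift u, h.lift v⁆ - h.lift ⁅u, v⁆)
  simp only [coe_curvature, lift_add, lift_smul, VField.lie_smul_fn, lie_lift_pullbackFn, smul_sub]
  abel

/-- Contraction of vertical forms with a vertical vector field. -/
def contract {q : ℕ} (X : Ver p) : VForm p (q + 1) →ₗ[SmoothFn F B] VForm p q where
  toFun η := η.curryLeft X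
  map_add' _ _ := rfl
  map_smul' _ _ := rfl

/-- `(u, v) ↦ i_{C(u, v)} ∘ Θ` -/
def contractCurvature {a q : ℕ} (Θ : BForm p a (q + 1)) :
    VField F B →ₗ[SmoothFn F B] VField F B →ₗ[SmoothFn F B] BForm p a q :=
  LinearMap.mk₂ _ (fun u v => (contract (h.curvature u v)).compAlternatingMap Θ)
    (fun u v w => by
      ext x : 1
      change (Θ x).curryLeft _ = (Θ x).curryLeft _ + (Θ x).curryLeft _
      rw [curvature_swap, curvature_add, curvature_swap h u, curvature_swap h v]
      simp only [map_neg, map_add]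
      abel)
    (fun f u v => by
      ext x : 1
      change (Θ x).curryLeft _ = pullbackFn p f • (Θ x).curryLeft _
      rw [curvature_swap, curvature_smul, curvature_swap h u]
      simp only [map_neg, map_smul, smul_neg])
    (fun u v w => by
      ext x : 1
      change (Θ x).curryLeft _ = (Θ x).curryLeft _ + (Θ x).curryLeft _
      rw [curvature_add, map_add])
    (fun f u v => by
      ext x : 1
      change (Θ x).curryLeft _ = pullbackFn p f • (Θ x).curryLeft _
      rw [curvature_smul, map_smul])

lemma contractCurvature_swap {a q : ℕ} (Θ : BForm p a (q + 1)) (u v : VField F B) :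
    h.contractCurvature Θ u v = -h.contractCurvature Θ v u := by
  ext x : 1
  change (Θ x).curryLeft _ = -(Θ x).curryLeft _
  rw [curvature_swap, map_neg]

/-- The operator `d^C`:
`(d^C Θ)(v₀, …) = (-1)^a ∑_{i < j} (-1)^(i + j) i_{C(vᵢ, vⱼ)} Θ(v₀, …, v̂ᵢ, …, v̂ⱼ, …)`. -/
def dC {a q : ℕ} (Θ : BForm p a (q + 1)) : BForm p (a + 2) q :=
  (-1 : ℤ) ^ a • pairSum (h.contractCurvature Θ) (h.contractCurvature_swap Θ)

end EhresmannConnection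

/-- `p` is a fibration: a smooth submersion that admits a complete Ehresmann connection. -/
def IsFibration (p : C^∞⟮𝓘(ℝ, E), M; 𝓘(ℝ, F), B⟯) : Prop :=
  Manifold.IsSubmersion 𝓘(ℝ, E) 𝓘(ℝ, F) ∞ p ∧ ∃ h : EhresmannConnection p, h.IsComplete

variable (p) in
/-- The image of `d^V` in `Ω^a(B, Ω^q(Ver))`. -/
def rangeDV (a : ℕ) : (q : ℕ) → Submodule ℝ (BForm p a q)
  | 0 => ⊥
  | q + 1 => LinearMap.range (dV p a q)

variable (p) in
/-- `E₁^{a,q} = Ω^a(B, H^q(Ver))`: the cohomology of `d^V` on `Ω^a(B, Ω^q(Ver))`. -/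
abbrev E1 (a q : ℕ) : Type _ :=
  LinearMap.ker (dV p a q) ⧸ (rangeDV p a q).submoduleOf (LinearMap.ker (dV p a q))

/-- The class `[Θ]₁`. -/
def E1.mk {a q : ℕ} (Θ : BForm p a q) (hΘ : dV p a q Θ = 0) : E1 p a q :=
  Submodule.Quotient.mk ⟨Θ, hΘ⟩

namespace EhresmannConnection

variable (h : EhresmannConnection p)

lemma dH_mem_ker (a q : ℕ) (Θ : BForm p a q) (hΘ : Θ ∈ LinearMap.ker (dV p a q)) :
    h.dH a q Θ ∈ LinearMap.ker (dV p (a + 1) q) := by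
  rw [LinearMap.mem_ker] at hΘ ⊢
  rw [dV_dH, hΘ, map_zero, neg_zero]

lemma dH_mem_rangeDV (a q : ℕ) (Θ : BForm p a q) (hΘ : Θ ∈ rangeDV p a q) :
    h.dH a q Θ ∈ rangeDV p (a + 1) q := by
  cases q with
  | zero =>
    obtain rfl : Θ = 0 := hΘ
    exact (map_zero (h.dH a 0)).symm ▸ Submodule.zero_mem _
  | succ q =>
    obtain ⟨Λ, rfl⟩ := hΘ
    exact ⟨-h.dH a q Λ, by rw [map_neg, dV_dH, neg_neg]⟩

/-- The differential `d₁` of `E₁`, induced by `d^H`. -/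
def d1 (a q : ℕ) : E1 p a q →ₗ[ℝ] E1 p (a + 1) q :=
  Submodule.mapQ _ _ ((h.dH a q).restrict (h.dH_mem_ker a q))
    fun Θ hΘ => h.dH_mem_rangeDV a q Θ hΘ

/-- The image of `d₁` in `E₁^{a,q}`. -/
def rangeD1 (q : ℕ) : (a : ℕ) → Submodule ℝ (E1 p a q)
  | 0 => ⊥
  | a + 1 => LinearMap.range (h.d1 a q)

/-- `H^a(B, H^q(Ver)) = E₂^{a,q}`: the cohomology of `d₁` on `Ω^a(B, H^q(Ver))`. -/
abbrev E2 (a q : ℕ) : Type _ :=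
  LinearMap.ker (h.d1 a q) ⧸ (h.rangeD1 q a).submoduleOf (LinearMap.ker (h.d1 a q))

/-- The class in `E₂` of a `d₁`-closed element of `E₁`. -/
def E2.mk {a q : ℕ} (ξ : E1 p a q) (hξ : h.d1 a q ξ = 0) : h.E2 a q :=
  Submodule.Quotient.mk ⟨ξ, hξ⟩

/-- The connection is compatible with `Φ_V`: its parallel transport preserves `Φ_V`. -/
def IsCompatible (Φ : VForm p 3) : Prop := h.dH 0 3 (BForm.ofVForm p Φ) = 0

end EhresmannConnection

/-- A vertical `3`-form is non-degenerate: `i_X Φ_V = 0` at a point only if `X = 0` there. -/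
def VForm.IsNondegenerate (Φ : VForm p 3) : Prop :=
  ∀ (x : M) (X : Ver p), (∀ Y Z : Ver p, Φ ![X, Y, Z] x = 0) → (X : VField E M) x = 0

/-- `(p : M → B, Φ_V)` is a fibration with `2`-plectic fibres. -/
structure IsFibrationWithTwoPlecticFibres (p : C^∞⟮𝓘(ℝ, E), M; 𝓘(ℝ, F), B⟯) (Φ : VForm p 3) :
    Prop where
  isFibration : IsFibration p
  closed : dVer p 3 Φ = 0
  nondegenerate : Φ.IsNondegenerate

/-- `(p : M → B, Φ_V)` is a `2`-plectic fibration. -/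
structure IsTwoPlecticFibration (p : C^∞⟮𝓘(ℝ, E), M; 𝓘(ℝ, F), B⟯) (Φ : VForm p 3) : Prop
    extends IsFibrationWithTwoPlecticFibres p Φ where
  exists_compatible : ∃ h : EhresmannConnection p, h.IsCompatible Φ

variable (E M) in
/-- The `k`-forms on `M`. -/
abbrev DForm (k : ℕ) := CEForm (SmoothFn E M) (VField E M) k

/-- The restriction of a form on `M` to the fibres. -/
def DForm.vert (p : C^∞⟮𝓘(ℝ, E), M; 𝓘(ℝ, F), B⟯) {k : ℕ} (Ψ : DForm E M k) : VForm p k :=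
  Ψ.compLinearMap (Ver p).toSubmodule.subtype

/-- `Φ_V` extends to a closed `3`-form on the total space. -/
def HasClosedExtension (Φ : VForm p 3) : Prop :=
  ∃ Ψ : DForm E M 3, ceD 3 Ψ = 0 ∧ Ψ.vert p = Φ

end Connection

end

/-!
Everything is Cartan calculus on the vertical forms. The vertical vector fields form a Lie-Rinehart
algebra, so Cartan's formula `L_X = d i_X + i_X d` (`ceD_cartan`) and `[L_X, i_Y] = i_{[X, Y]}`
(`ceLie_curryLeft`) hold for `d_V`, and equally for the de Rham differential of the total space.
No locality or partition of unity is used.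

*The class is defined.* If `L_{h(u)} Φ_V = 0` for all `u`, then
`d_V i_{C(u, v)} Φ_V = L_{C(u, v)} Φ_V = ([L_{h(u)}, L_{h(v)}] - L_{h([u, v])}) Φ_V = 0`
(`ceLie_curvature`), which is `d^V d^C Φ_V = 0`. Since `L_{h(u)}` annihilates `Φ_V`, it passes
through `i_{C(v, w)} Φ_V` onto the curvature, and `d^H d^C Φ_V = 0` becomes the Bianchi identity
(`curvature_bianchi`).

*Vanishing.* Unwinding the two quotients, `[d^C Φ_V]₂ = 0` says that
`d^C Φ_V = d^H α + d^V β` with `d^V α = 0` (`E2_mk_eq_iff`); as `d^H Φ_V = 0`, these are the two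
closedness equations up to the signs of `α` and `β`. A closed extension `Ψ` solves them with
`α(u) = i_{h(u)} Ψ` and `β(u, v) = i_{h(v)} i_{h(u)} Ψ` restricted to the fibres, by
`L_{h(u)} Ψ = d i_{h(u)} Ψ`.

*Independence.* The horizontal lifts of two connections differ by a vertical `Y_u = h'(u) - h(u)`
that is `C^∞(B)`-linear in `u`. Hence `d^{H'} - d^H` is built from the `L_{Y_u}`, which by Cartan's
formula map `d_V`-closed forms to `d_V`-exact ones (`dH_sub_mem_rangeDV`). For compatible
connections also `L_{Y_u} Φ_V = 0`, and contracting `Φ_V` with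
`C'(u, v) = C(u, v) + [h(u), Y_v] - [h(v), Y_u] - Y_{[u, v]} + [Y_u, Y_v]` shows that
`d^{C'} Φ_V` and `d^C Φ_V` differ by `d^H α + d^V β` with `α(u) = i_{Y_u} Φ_V` and
`β(u, v) = i_{Y_u} i_{Y_v} Φ_V`.
-/

noncomputable section
set_option linter.unusedSectionVars false

/-! ### Cartan calculus on a Lie-Rinehart algebra -/

section CartanCalculus

variable {A N : Type*} [CommRing A] [Algebra ℝ A]
  [AddCommGroup N] [Module A N] [Module ℝ N] [IsScalarTower ℝ A N] {q : ℕ}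

section LieAlt

variable {V : Type*} [AddCommGroup V] [Module ℝ V] [Module A V]

lemma lieAlt_apply (δ : N →ₗ[ℝ] N) (T : V →ₗ[ℝ] V) (σ : A → A)
    (h1 : ∀ (a : A) n, δ (a • n) = a • δ n + σ a • n)
    (h2 : ∀ (a : A) v, T (a • v) = a • T v + σ a • v) (θ : V [⋀^Fin q]→ₗ[A] N) (v : Fin q → V) :
    lieAlt δ T σ h1 h2 θ v = δ (θ v) - ∑ k, θ (Function.update v k (T (v k))) := rfl

/-- `[L, i_x] = i_{T x}` for the derivation `L` of forms induced by `δ` and `T`. -/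
lemma lieAlt_curryLeft (δ : N →ₗ[ℝ] N) (T : V →ₗ[ℝ] V) (σ : A → A)
    (h1 : ∀ (a : A) n, δ (a • n) = a • δ n + σ a • n)
    (h2 : ∀ (a : A) v, T (a • v) = a • T v + σ a • v)
    (θ : V [⋀^Fin (q + 1)]→ₗ[A] N) (x : V) :
    lieAlt δ T σ h1 h2 (θ.curryLeft x) =
      (lieAlt δ T σ h1 h2 θ).curryLeft x + θ.curryLeft (T x) := by
  ext v
  simp only [AlternatingMap.curryLeft_apply_apply, lieAlt_apply, Fin.sum_univ_succ,
    AlternatingMap.add_apply]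
  simp only [Matrix.vecCons, Fin.cons_update, Fin.update_cons_zero, Fin.cons_zero, Fin.cons_succ]
  abel

/-- The commutator of the derivations of forms induced by `(δ₁, T₁)` and `(δ₂, T₂)` is induced by
`([δ₁, δ₂], [T₁, T₂])`: the terms in which `T₁` and `T₂` act on different arguments cancel. -/
lemma lieFun_comm (δ₁ δ₂ : N →ₗ[ℝ] N) (T₁ T₂ : V →ₗ[ℝ] V) (θ : V [⋀^Fin q]→ₗ[A] N)
    (v : Fin q → V) :
    lieFun δ₁ T₁ (lieFun δ₂ T₂ θ) v - lieFun δ₂ T₂ (lieFun δ₁ T₁ θ) v =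
      δ₁ (δ₂ (θ v)) - δ₂ (δ₁ (θ v)) -
        ∑ k, θ (Function.update v k (T₁ (T₂ (v k)) - T₂ (T₁ (v k)))) := by
  have key : ∀ S U : V →ₗ[ℝ] V,
      ∑ k, ∑ l, θ (Function.update (Function.update v k (S (v k))) l
        (U (Function.update v k (S (v k)) l))) =
      ∑ k, θ (Function.update v k (U (S (v k)))) +
      ∑ k, ∑ l ∈ Finset.univ.erase k,
        θ (Function.update (Function.update v l (U (v l))) k (S (v k))) := by
    intro S U
    rw [← Finset.sum_add_distrib]
    refine Finset.sum_congr rfl fun k _ => ?_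
    rw [sum_update_update U θ v k]
  have swap : ∑ k, ∑ l ∈ Finset.univ.erase k,
        θ (Function.update (Function.update v l (T₂ (v l))) k (T₁ (v k))) =
      ∑ k, ∑ l ∈ Finset.univ.erase k,
        θ (Function.update (Function.update v l (T₁ (v l))) k (T₂ (v k))) := by
    rw [Finset.sum_comm' (t' := Finset.univ) (s' := fun l => Finset.univ.erase l)
      (by simp [eq_comm])]
    refine Finset.sum_congr rfl fun k _ => Finset.sum_congr rfl fun l hl => ?_
    rw [Function.update_comm (Finset.ne_of_mem_erase hl).symm]
  simp only [lieFun, map_sub, map_sum, Finset.sum_sub_distrib, AlternatingMap.map_update_sub]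
  rw [key, key, swap]
  abel

end LieAlt

variable {L : Type*} [LieRing L] [LieAlgebra ℝ L] [Module A L]
  [LieRingModule L A] [LieRinehartRing A L] [LieRinehartAlgebra ℝ A L]

/-- The Lie derivative `L_x` on the alternating forms of a Lie-Rinehart algebra. -/
def ceLie (x : L) : CEForm A L q →ₗ[ℝ] CEForm A L q :=
  lieAlt (LieModule.toEnd ℝ L A x) (LieAlgebra.ad ℝ L x) (fun a => ⁅x, a⁆)
    (fun a b => by simp)
    (fun a y => by simp)

lemma ceLie_apply (x : L) (θ : CEForm A L q) (v : Fin q → L) :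
    ceLie x θ v = ⁅x, θ v⁆ - ∑ k, θ (Function.update v k ⁅x, v k⁆) := rfl

lemma ceLie_curryLeft (x y : L) (θ : CEForm A L (q + 1)) :
    ceLie x (θ.curryLeft y) = (ceLie x θ).curryLeft y + θ.curryLeft ⁅x, y⁆ :=
  lieAlt_curryLeft _ _ _ _ _ θ y

lemma removeNth_zero_cons {n : ℕ} (y : L) (w : Fin n → L) :
    (0 : Fin (n + 1)).removeNth (Fin.cons y w : Fin (n + 1) → L) = w := by
  ext k; simp [Fin.removeNth_apply]

/-- Moving an entry to the front costs the sign of its position. -/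
lemma map_update_eq_curryLeft {n : ℕ} (θ : CEForm A L (n + 1)) (w : Fin (n + 1) → L)
    (j : Fin (n + 1)) (z : L) :
    θ (Function.update w j z) = (-1 : ℤ) ^ (j : ℕ) • θ.curryLeft z (j.removeNth w) := by
  rw [← Fin.insertNth_removeNth, AlternatingMap.map_insertNth]
  simp

/-- Cartan's formula `i_x d + d i_x = L_x` on forms of positive degree. -/
lemma ceD_cartan (x : L) (θ : CEForm A L (q + 1)) :
    (ceD (q + 1) θ).curryLeft x + ceD q (θ.curryLeft x) = ceLie x θ := by
  ext w
  have hIci : Finset.Ici (0 : Fin (q + 1)) = Finset.univ := by ext; simp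
  have hlin : ∀ (y : L) (u : Fin q → L), θ (Fin.cons y u : Fin (q + 1) → L) = θ.curryLeft y u :=
    fun _ _ => rfl
  -- the Koszul formula, with the terms that involve the argument `x` split off
  have e : (ceD (q + 1) θ).curryLeft x w =
      ⁅x, θ w⁆
      + ∑ i : Fin (q + 1), (-1 : ℤ) ^ ((i : ℕ) + 1) • ⁅w i, θ.curryLeft x (i.removeNth w)⁆
      + (∑ j : Fin (q + 1), (-1 : ℤ) ^ ((j : ℕ) + 1) • θ.curryLeft ⁅x, w j⁆ (j.removeNth w)
      + ∑ i : Fin q, ∑ j ∈ Finset.Ici i.succ, (-1 : ℤ) ^ ((i : ℕ) + 1 + (j : ℕ) + 1) •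
          θ.curryLeft ⁅w i.castSucc, w j⁆ (j.removeNth (i.succ.castSucc.removeNth
            (Fin.cons x w : Fin (q + 2) → L)))) := by
    change koszulFun _ θ (Fin.cons x w : Fin (q + 2) → L) = _
    simp only [koszulFun, bracketSum, pairSumFun]
    congr 1
    · rw [Fin.sum_univ_succ]
      simp only [Fin.cons_zero, Fin.cons_succ, removeNth_succ_cons, hlin, Fin.val_zero,
        Fin.val_succ, pow_zero, one_smul, removeNth_zero_cons, LConn.canonical_apply]
    · rw [Fin.sum_univ_succ]
      simp only [Fin.cons_succ, hIci, Fin.val_zero, Fin.val_succ, zero_add, ← Fin.succ_castSucc,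
        Fin.castSucc_zero, Fin.cons_zero, removeNth_zero_cons]
  -- the remaining bracket terms cancel those of `d i_x θ`
  have hb : bracketSum (θ.curryLeft x) w =
      -∑ i : Fin q, ∑ j ∈ Finset.Ici i.succ, (-1 : ℤ) ^ ((i : ℕ) + 1 + (j : ℕ) + 1) •
          θ.curryLeft ⁅w i.castSucc, w j⁆ (j.removeNth (i.succ.castSucc.removeNth
            (Fin.cons x w : Fin (q + 2) → L))) := by
    cases q with
    | zero => simp [bracketSum]
    | succ n =>
      have hs : ∀ i : Fin (n + 1), Finset.Ici i.succ = (Finset.Ici i).map (Fin.succEmb (n + 1)) := by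
        intro i; ext j; refine Fin.cases ?_ (fun j => ?_) j <;> simp
      simp only [bracketSum, pairSumFun, hs, Finset.sum_map, ← Finset.sum_neg_distrib]
      refine Finset.sum_congr rfl fun i _ => Finset.sum_congr rfl fun j _ => ?_
      rw [← Fin.succ_castSucc, removeNth_succ_cons]
      simp only [Fin.coe_succEmb]
      rw [removeNth_succ_cons]
      -- exchanging the first two entries of `θ` accounts for the sign
      have hswap : θ.curryLeft ⁅w i.castSucc, w j.succ⁆
            (Fin.cons x (j.removeNth (i.castSucc.removeNth w))) =
          -(θ.curryLeft x).curryLeft ⁅w i.castSucc, w j.succ⁆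
            (j.removeNth (i.castSucc.removeNth w)) := by
        have := θ.map_swap (i := 0) (j := 1) (Fin.cons x (Fin.cons ⁅w i.castSucc, w j.succ⁆
          (j.removeNth (i.castSucc.removeNth w)))) (by simp)
        rw [AlternatingMap.curryLeft_apply_apply, AlternatingMap.curryLeft_apply_apply,
          AlternatingMap.curryLeft_apply_apply]
        simp only [Matrix.vecCons]
        rw [← this]
        congr 1
        ext k
        refine Fin.cases ?_ (fun k => Fin.cases ?_ (fun k => ?_) k) k
        · simp
        · simp
        · rw [Function.comp_apply, Equiv.swap_apply_of_ne_of_ne (by simp)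
            (by simp [Fin.ext_iff])]
          simp
      rw [hswap]
      simp only [Fin.val_succ, pow_succ]
      simp
      ring
  have hc : ceD q (θ.curryLeft x) w = ∑ i : Fin (q + 1), (-1 : ℤ) ^ (i : ℕ) •
      ⁅w i, θ.curryLeft x (i.removeNth w)⁆ + bracketSum (θ.curryLeft x) w := rfl
  rw [AlternatingMap.add_apply, e, hc, hb, ceLie_apply]
  simp only [map_update_eq_curryLeft, pow_succ, mul_neg_one, neg_smul, Finset.sum_neg_distrib]
  abel

lemma ceD_curryLeft_of_closed {θ : CEForm A L (q + 1)} (x : L) (hθ : ceD (q + 1) θ = 0) :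
    ceD q (θ.curryLeft x) = ceLie x θ := by
  rw [← ceD_cartan, hθ, AlternatingMap.curryLeft_zero, LinearMap.zero_apply, zero_add]

/-- `i_{[x, y]} = L_x i_y` on forms invariant under `x`. -/
lemma ceLie_curryLeft_of_invariant {θ : CEForm A L (q + 1)} {x : L} (y : L) (hθ : ceLie x θ = 0) :
    ceLie x (θ.curryLeft y) = θ.curryLeft ⁅x, y⁆ := by
  rw [ceLie_curryLeft, hθ, AlternatingMap.curryLeft_zero, LinearMap.zero_apply, zero_add]

/-- Cartan's formula in degree `0`. -/
lemma ceD_cartan_zero (x : L) (θ : CEForm A L 0) :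
    (ceD 0 θ).curryLeft x = ceLie x θ := by
  ext w
  change koszulFun _ θ _ = _
  simp only [koszulFun, bracketSum, ceLie_apply]
  simp

end CartanCalculus

/-! ### Covariant derivatives in low degree -/

section LowDegree

variable {A L N : Type*} [CommRing A] [Algebra ℝ A] [LieRing L] [LieAlgebra ℝ L] [Module A L]
  [LieRingModule L A] [LieRinehartRing A L] [LieRinehartAlgebra ℝ A L]
  [AddCommGroup N] [Module A N] [Module ℝ N] [IsScalarTower ℝ A N]

/-- A bilinear map that vanishes on the diagonal, as an alternating map of two arguments. -/
def alternatingOfBilin (f : L →ₗ[A] L →ₗ[A] N) (hf : ∀ x, f x x = 0) : Cochain A L N 2 where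
  toFun v := f (v 0) (v 1)
  map_update_add' v i x y := by
    fin_cases i <;> simp
  map_update_smul' v i c x := by
    fin_cases i <;> simp
  map_eq_zero_of_eq' v i j hv hij := by
    fin_cases i <;> fin_cases j <;> simp_all

lemma koszul_zero_apply (D : LConn A L N) (θ : Cochain A L N 0) (n : N) (hθ : ∀ v, θ v = n)
    (v : Fin 1 → L) : koszul 0 D θ v = D.toFun (v 0) n := by
  simp [koszul_apply, bracketSum, hθ]

lemma koszul_one_apply (D : LConn A L N) (θ : Cochain A L N 1) (f : L → N)
    (hθ : ∀ v, θ v = f (v 0)) (v : Fin 2 → L) :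
    koszul 1 D θ v = D.toFun (v 0) (f (v 1)) - D.toFun (v 1) (f (v 0)) - f ⁅v 0, v 1⁆ := by
  have hIci : Finset.Ici (0 : Fin 1) = {0} := by decide
  simp [koszul_apply, bracketSum, pairSumFun, hθ, Fin.sum_univ_succ, Fin.removeNth_apply, hIci]
  abel

lemma koszul_two_apply (D : LConn A L N) (θ : Cochain A L N 2) (f : L → L → N)
    (hθ : ∀ v, θ v = f (v 0) (v 1)) (v : Fin 3 → L) :
    koszul 2 D θ v = D.toFun (v 0) (f (v 1) (v 2)) - D.toFun (v 1) (f (v 0) (v 2)) +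
      D.toFun (v 2) (f (v 0) (v 1)) - f ⁅v 0, v 1⁆ (v 2) + f ⁅v 0, v 2⁆ (v 1) -
      f ⁅v 1, v 2⁆ (v 0) := by
  have hIci : Finset.Ici (0 : Fin 2) = {0, 1} := by decide
  have hIci' : Finset.Ici (1 : Fin 2) = {1} := by decide
  simp [koszul_apply, bracketSum, pairSumFun, hθ, Fin.sum_univ_succ, Fin.removeNth_apply, hIci,
    hIci', Matrix.vecCons]
  abel

end LowDegree

/-! ### Lie derivatives and curvature on vertical forms -/

section Vertical

variable {E F M B : Type*} [NormedAddCommGroup E] [NormedSpace ℝ E] [FiniteDimensional ℝ E]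
  [NormedAddCommGroup F] [NormedSpace ℝ F] [FiniteDimensional ℝ F]
  [TopologicalSpace M] [ChartedSpace E M] [IsManifold 𝓘(ℝ, E) ∞ M] [T2Space M]
  [TopologicalSpace B] [ChartedSpace F B] [IsManifold 𝓘(ℝ, F) ∞ B] [T2Space B]
  {p : C^∞⟮𝓘(ℝ, E), M; 𝓘(ℝ, F), B⟯}

namespace DForm

lemma vert_curryLeft {k : ℕ} (Ψ : DForm E M (k + 1)) (X : Ver p) :
    (Ψ.vert p).curryLeft X = vert p (Ψ.curryLeft (X : VField E M)) := by
  ext v : 1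
  change Ψ _ = Ψ _
  congr 1
  funext i
  refine Fin.cases ?_ (fun i => ?_) i <;> rfl

lemma vert_add {k : ℕ} (Ψ Ψ' : DForm E M k) : vert p (Ψ + Ψ') = vert p Ψ + vert p Ψ' := rfl

lemma vert_sub {k : ℕ} (Ψ Ψ' : DForm E M k) : vert p (Ψ - Ψ') = vert p Ψ - vert p Ψ' := rfl

/-- Restriction to the fibres commutes with the de Rham differentials. -/
lemma dVer_vert {k : ℕ} (Ψ : DForm E M k) : dVer p k (Ψ.vert p) = vert p (ceD k Ψ) := by
  ext v : 1
  cases k with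
  | zero => rfl
  | succ k =>
    change koszulFun _ _ _ = koszulFun _ _ _
    simp only [koszulFun, bracketSum, pairSumFun, vert_curryLeft]
    rfl

end DForm

namespace EhresmannConnection

variable (h h' : EhresmannConnection p)

/-- The Lie derivative along a horizontal lift commutes with restriction to the fibres. -/
lemma lieHor_vert {k : ℕ} (u : VField F B) (Ψ : DForm E M k) :
    h.lieHor u (Ψ.vert p) = DForm.vert p (ceLie (h.lift u) Ψ) := by
  ext v : 1
  rw [lieHor_apply]
  change _ = ⁅h.lift u, _⁆ - ∑ k, Ψ _
  congr 1
  refine Finset.sum_congr rfl fun i _ => ?_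
  change Ψ _ = Ψ _
  congr 1
  funext j
  by_cases hj : j = i
  · subst hj
    simp only [Function.update_self]
    rfl
  · simp [hj]

lemma lieHor_curryLeft {k : ℕ} (u : VField F B) (η : VForm p (k + 1)) (X : Ver p) :
    h.lieHor u (η.curryLeft X) = (h.lieHor u η).curryLeft X + η.curryLeft (h.adVer u X) :=
  lieAlt_curryLeft _ _ _ _ _ η X

/-- The curvature measures the failure of `u ↦ L_{h(u)}` to preserve brackets:
`L_{C(u, v)} = [L_{h(u)}, L_{h(v)}] - L_{h([u, v])}` on vertical forms. -/
lemma ceLie_curvature {k : ℕ} (u v : VField F B) (η : VForm p k) :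
    ceLie (h.curvature u v) η =
      h.lieHor u (h.lieHor v η) - h.lieHor v (h.lieHor u η) - h.lieHor ⁅u, v⁆ η := by
  ext X : 1
  have key := lieFun_comm (LieModule.toEnd ℝ (VField E M) (SmoothFn E M) (h.lift u))
    (LieModule.toEnd ℝ (VField E M) (SmoothFn E M) (h.lift v)) (h.adVer u) (h.adVer v) η X
  have hC : ∀ Y : Ver p, ⁅h.curvature u v, Y⁆ =
      (h.adVer u (h.adVer v Y) - h.adVer v (h.adVer u Y)) - h.adVer ⁅u, v⁆ Y := by
    intro Y
    refine Subtype.ext ?_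
    change ⁅⁅h.lift u, h.lift v⁆ - h.lift ⁅u, v⁆, (Y : VField E M)⁆ =
      ⁅h.lift u, ⁅h.lift v, (Y : VField E M)⁆⁆ - ⁅h.lift v, ⁅h.lift u, (Y : VField E M)⁆⁆ -
        ⁅h.lift ⁅u, v⁆, (Y : VField E M)⁆
    rw [sub_lie, lie_lie]
  have hf : ∀ f : SmoothFn E M, ⁅h.curvature u v, f⁆ =
      ⁅h.lift u, ⁅h.lift v, f⁆⁆ - ⁅h.lift v, ⁅h.lift u, f⁆⁆ - ⁅h.lift ⁅u, v⁆, f⁆ := by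
    intro f
    change ⁅⁅h.lift u, h.lift v⁆ - h.lift ⁅u, v⁆, f⁆ = _
    rw [sub_lie, lie_lie]
  change _ = lieFun _ _ (lieFun _ _ η) X - lieFun _ _ (lieFun _ _ η) X - h.lieHor ⁅u, v⁆ η X
  rw [key, lieHor_apply, ceLie_apply, hf]
  simp only [hC, AlternatingMap.map_update_sub, Finset.sum_sub_distrib]
  simp only [LieModule.toEnd_apply_apply]
  abel

lemma lift_neg (u : VField F B) : h.lift (-u) = -h.lift u := by
  simpa using h.lift_smul (-1) u

/-- The Bianchi identity. -/
lemma curvature_bianchi (u v w : VField F B) :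
    h.adVer u (h.curvature v w) - h.adVer v (h.curvature u w) + h.adVer w (h.curvature u v) -
      h.curvature ⁅u, v⁆ w + h.curvature ⁅u, w⁆ v - h.curvature ⁅v, w⁆ u = 0 := by
  refine Subtype.ext ?_
  change ⁅h.lift u, ⁅h.lift v, h.lift w⁆ - h.lift ⁅v, w⁆⁆ -
    ⁅h.lift v, ⁅h.lift u, h.lift w⁆ - h.lift ⁅u, w⁆⁆ +
    ⁅h.lift w, ⁅h.lift u, h.lift v⁆ - h.lift ⁅u, v⁆⁆ -
    (⁅h.lift ⁅u, v⁆, h.lift w⁆ - h.lift ⁅⁅u, v⁆, w⁆) +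
    (⁅h.lift ⁅u, w⁆, h.lift v⁆ - h.lift ⁅⁅u, w⁆, v⁆) -
    (⁅h.lift ⁅v, w⁆, h.lift u⁆ - h.lift ⁅⁅v, w⁆, u⁆) = 0
  have hl : h.lift ⁅⁅u, v⁆, w⁆ = h.lift ⁅⁅u, w⁆, v⁆ + -h.lift ⁅⁅v, w⁆, u⁆ := by
    rw [← h.lift_neg, ← h.lift_add, lie_lie u v w, ← lie_skew u ⁅v, w⁆, ← lie_skew v ⁅u, w⁆]
    congr 1
    abel
  rw [hl, ← lie_skew (h.lift ⁅u, v⁆), ← lie_skew (h.lift ⁅u, w⁆), ← lie_skew (h.lift ⁅v, w⁆)]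
  simp only [lie_sub]
  rw [leibniz_lie (h.lift u) (h.lift v) (h.lift w), ← lie_skew (h.lift w) ⁅h.lift u, h.lift v⁆]
  abel

/-! ### The difference of two connections -/

/-- The difference of the horizontal lifts of two connections, a vertical vector field. -/
def liftDiff (u : VField F B) : Ver p :=
  ⟨h'.lift u - h.lift u, fun x => by
    rw [ContMDiffSection.coe_sub, Pi.sub_apply, map_sub, mfderiv_lift, mfderiv_lift, sub_self]⟩

lemma liftDiff_add (u v : VField F B) :
    h.liftDiff h' (u + v) = h.liftDiff h' u + h.liftDiff h' v := by
  refine Subtype.ext ?_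
  change h'.lift (u + v) - h.lift (u + v) = (h'.lift u - h.lift u) + (h'.lift v - h.lift v)
  rw [lift_add, lift_add]
  abel

lemma liftDiff_smul (f : SmoothFn F B) (u : VField F B) :
    h.liftDiff h' (f • u) = pullbackFn p f • h.liftDiff h' u := by
  refine Subtype.ext ?_
  change h'.lift (f • u) - h.lift (f • u) = pullbackFn p f • (h'.lift u - h.lift u)
  rw [lift_smul, lift_smul, smul_sub]

lemma lieHor_eq_add_ceLie {k : ℕ} (u : VField F B) (η : VForm p k) :
    h'.lieHor u η = h.lieHor u η + ceLie (h.liftDiff h' u) η := by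
  ext X : 1
  have hl : h'.lift u = h.lift u + (h.liftDiff h' u : VField E M) :=
    (add_sub_cancel (h.lift u) (h'.lift u)).symm
  have hT : ∀ Y : Ver p, h'.adVer u Y = h.adVer u Y + ⁅h.liftDiff h' u, Y⁆ := fun Y => by
    refine Subtype.ext ?_
    rw [coe_adVer, hl, add_lie]
    rfl
  rw [AlternatingMap.add_apply, lieHor_apply, lieHor_apply, ceLie_apply, hl, add_lie]
  simp only [hT, AlternatingMap.map_update_add, Finset.sum_add_distrib]
  change (_ + ⁅h.liftDiff h' u, _⁆) - _ = _
  abel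

/-- `C'(u, v) = C(u, v) + [h(u), Y_v] - [h(v), Y_u] - Y_{[u, v]} + [Y_u, Y_v]` for two connections
with `Y = h' - h`. -/
lemma curvature_eq_add (u v : VField F B) :
    h'.curvature u v = h.curvature u v + h.adVer u (h.liftDiff h' v) -
      h.adVer v (h.liftDiff h' u) - h.liftDiff h' ⁅u, v⁆ + ⁅h.liftDiff h' u, h.liftDiff h' v⁆ := by
  refine Subtype.ext ?_
  change ⁅h'.lift u, h'.lift v⁆ - h'.lift ⁅u, v⁆ = ⁅h.lift u, h.lift v⁆ - h.lift ⁅u, v⁆ +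
    ⁅h.lift u, h'.lift v - h.lift v⁆ - ⁅h.lift v, h'.lift u - h.lift u⁆ -
    (h'.lift ⁅u, v⁆ - h.lift ⁅u, v⁆) + ⁅h'.lift u - h.lift u, h'.lift v - h.lift v⁆
  simp only [lie_sub, sub_lie]
  rw [← lie_skew (h.lift v) (h'.lift u), ← lie_skew (h.lift v) (h.lift u)]
  abel

/-- Contraction with the difference of the horizontal lifts, as an operator that raises the base
degree: `∑_i (-1)^i i_{Y_{v_i}} Θ(v₀, …, v̂_i, …)` with `Y = h' - h`. -/
def contractDiff {a q : ℕ} (Θ : BForm p a (q + 1)) : BForm p (a + 1) q :=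
  AlternatingMap.alternatizeUncurryFin
    { toFun := fun u => (contract (h.liftDiff h' u)).compAlternatingMap Θ
      map_add' := fun u v => by
        ext w : 1
        change (Θ w).curryLeft _ = (Θ w).curryLeft _ + (Θ w).curryLeft _
        rw [liftDiff_add, map_add]
      map_smul' := fun f u => by
        ext w : 1
        change (Θ w).curryLeft _ = pullbackFn p f • (Θ w).curryLeft _
        rw [liftDiff_smul, map_smul] }

lemma contractDiff_apply {a q : ℕ} (Θ : BForm p a (q + 1)) (v : Fin (a + 1) → VField F B) :
    h.contractDiff h' Θ v =
      ∑ i : Fin (a + 1), (-1 : ℤ) ^ (i : ℕ) • (Θ (i.removeNth v)).curryLeft (h.liftDiff h' (v i)) := by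
  rw [contractDiff, AlternatingMap.alternatizeUncurryFin_apply]
  rfl

lemma dH_sub_apply {a q : ℕ} (Θ : BForm p a q) (v : Fin (a + 1) → VField F B) :
    (h'.dH a q Θ - h.dH a q Θ) v =
      ∑ i : Fin (a + 1), (-1 : ℤ) ^ (i : ℕ) • ceLie (h.liftDiff h' (v i)) (Θ (i.removeNth v)) := by
  change h'.dH a q Θ v - h.dH a q Θ v = _
  rw [dH, dH, koszul_apply, koszul_apply, add_sub_add_right_eq_sub, ← Finset.sum_sub_distrib]
  refine Finset.sum_congr rfl fun i _ => ?_
  exact (smul_sub ((-1 : ℤ) ^ (i : ℕ)) _ _).symm.trans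
    (congrArg _ (sub_eq_of_eq_add' (h.lieHor_eq_add_ceLie h' (v i) _)))

/-- On `d^V`-closed forms the operators `d^H` of two connections differ by a `d^V`-exact form; this
is Cartan's formula for the difference of the lifts. -/
lemma dH_sub_mem_rangeDV {a q : ℕ} (Θ : BForm p a q) (hΘ : dV p a q Θ = 0) :
    h'.dH a q Θ - h.dH a q Θ ∈ rangeDV p (a + 1) q := by
  have hcl : ∀ w, ceD q (Θ w) = 0 := fun w => by
    have := congrArg (fun Λ : BForm p a (q + 1) => Λ w) hΘ
    change (-1 : ℤ) ^ a • ceD q (Θ w) = 0 at this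
    rcases neg_one_pow_eq_or ℤ a with e | e <;> simpa [e] using this
  cases q with
  | zero =>
    have : h'.dH a 0 Θ - h.dH a 0 Θ = 0 := by
      ext v : 1
      rw [dH_sub_apply]
      refine Finset.sum_eq_zero fun i _ => ?_
      rw [← ceD_cartan_zero, hcl, AlternatingMap.curryLeft_zero, LinearMap.zero_apply, smul_zero]
    rw [this]
    exact Submodule.zero_mem _
  | succ q =>
    refine ⟨(-1 : ℤ) ^ (a + 1) • h.contractDiff h' Θ, ?_⟩
    ext v : 1
    rw [map_zsmul, AlternatingMap.smul_apply, dV_apply, smul_smul, ← mul_pow, dH_sub_apply,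
      contractDiff_apply, map_sum]
    simp only [mul_neg, mul_one, neg_neg, one_pow, one_smul]
    refine Finset.sum_congr rfl fun i _ => ?_
    rw [map_zsmul, ← ceD_curryLeft_of_closed _ (hcl _)]
    rfl

/-- The differential `d₁` is the same for all connections. -/
lemma d1_eq (a q : ℕ) : h.d1 a q = h'.d1 a q := by
  refine LinearMap.ext fun ξ => ?_
  obtain ⟨⟨Θ, hΘ⟩, rfl⟩ := Submodule.Quotient.mk_surjective _ ξ
  exact ((Submodule.Quotient.eq _).mpr (h'.dH_sub_mem_rangeDV h Θ hΘ))

/-! ### The class `[d^C Φ_V]₂` -/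

lemma dH_ofVForm_apply {q : ℕ} (η : VForm p q) (v : Fin 1 → VField F B) :
    h.dH 0 q (BForm.ofVForm p η) v = h.lieHor (v 0) η :=
  koszul_zero_apply _ _ _ (fun _ => rfl) v

lemma dC_ofVForm_apply {q : ℕ} (η : VForm p (q + 1)) (v : Fin 2 → VField F B) :
    h.dC (BForm.ofVForm p η) v = -η.curryLeft (h.curvature (v 0) (v 1)) := by
  have hIci : Finset.Ici (0 : Fin 1) = {0} := by decide
  have : h.dC (BForm.ofVForm p η) v = (-1 : ℤ) ^ 0 •
    pairSumFun (fun x y => h.contractCurvature (BForm.ofVForm p η) x y) v := rfl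
  rw [this, pairSumFun]
  simp [hIci]
  rfl

lemma dH_one_apply {q : ℕ} (Θ : BForm p 1 q) (f : VField F B → VForm p q)
    (hf : ∀ v, Θ v = f (v 0)) (v : Fin 2 → VField F B) :
    h.dH 1 q Θ v = h.lieHor (v 0) (f (v 1)) - h.lieHor (v 1) (f (v 0)) - f ⁅v 0, v 1⁆ :=
  koszul_one_apply _ _ _ hf v

lemma dH_two_apply {q : ℕ} (Θ : BForm p 2 q) (f : VField F B → VField F B → VForm p q)
    (hf : ∀ v, Θ v = f (v 0) (v 1)) (v : Fin 3 → VField F B) :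
    h.dH 2 q Θ v = h.lieHor (v 0) (f (v 1) (v 2)) - h.lieHor (v 1) (f (v 0) (v 2)) +
      h.lieHor (v 2) (f (v 0) (v 1)) - f ⁅v 0, v 1⁆ (v 2) + f ⁅v 0, v 2⁆ (v 1) -
      f ⁅v 1, v 2⁆ (v 0) :=
  koszul_two_apply _ _ _ hf v

section Compatible

variable {h h'} {Φ : VForm p 3}

lemma IsCompatible.lieHor_eq_zero (hc : h.IsCompatible Φ) (u : VField F B) :
    h.lieHor u Φ = 0 := by
  have := congrArg (fun Λ : BForm p 1 3 => Λ ![u]) hc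
  change h.dH 0 3 (BForm.ofVForm p Φ) ![u] = 0 at this
  rwa [dH_ofVForm_apply] at this

lemma IsCompatible.lieHor_curryLeft (hc : h.IsCompatible Φ) (u : VField F B) (X : Ver p) :
    h.lieHor u (Φ.curryLeft X) = Φ.curryLeft (h.adVer u X) := by
  rw [EhresmannConnection.lieHor_curryLeft, hc.lieHor_eq_zero, AlternatingMap.curryLeft_zero,
    LinearMap.zero_apply, zero_add]

/-- `d^V d^C Φ_V = 0`: by Cartan's formula `d_V i_{C(u, v)} Φ_V = L_{C(u, v)} Φ_V`, and this is
`([L_{h(u)}, L_{h(v)}] - L_{h([u, v])}) Φ_V`. -/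
lemma IsCompatible.dV_dC (hc : h.IsCompatible Φ) (hcl : dVer p 3 Φ = 0) :
    dV p 2 2 (h.dC (BForm.ofVForm p Φ)) = 0 := by
  have hcl' : ceD 3 Φ = 0 := hcl
  ext v : 1
  rw [dV_apply, dC_ofVForm_apply, map_neg]
  have : dVer p 2 (Φ.curryLeft (h.curvature (v 0) (v 1))) = 0 := by
    have e := ceD_curryLeft_of_closed (h.curvature (v 0) (v 1)) hcl'
    rw [ceLie_curvature, hc.lieHor_eq_zero,
      hc.lieHor_eq_zero, hc.lieHor_eq_zero, map_zero, map_zero, sub_zero, sub_zero] at e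
    exact e
  rw [this, neg_zero, smul_zero]
  rfl

/-- `d^H d^C Φ_V = 0`, by the Bianchi identity. -/
lemma IsCompatible.dH_dC (hc : h.IsCompatible Φ) : h.dH 2 2 (h.dC (BForm.ofVForm p Φ)) = 0 := by
  have hL : ∀ u x y : VField F B, h.lieHor u (-Φ.curryLeft (h.curvature x y)) =
      -Φ.curryLeft (h.adVer u (h.curvature x y)) := fun u x y => by
    rw [map_neg, hc.lieHor_curryLeft]
  ext v : 1
  rw [h.dH_two_apply _ (fun x y => -Φ.curryLeft (h.curvature x y)) (h.dC_ofVForm_apply Φ)]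
  simp only [hL]
  have key := congrArg (fun X => -Φ.curryLeft X) (h.curvature_bianchi (v 0) (v 1) (v 2))
  simp only [map_sub, map_add, map_zero, neg_zero] at key
  change _ = (0 : VForm p 2)
  rw [← key]
  abel

lemma IsCompatible.d1_dC (hc : h.IsCompatible Φ)
    (hV : dV p 2 2 (h.dC (BForm.ofVForm p Φ)) = 0) :
    h.d1 2 2 (E1.mk (h.dC (BForm.ofVForm p Φ)) hV) = 0 := by
  refine (Submodule.Quotient.mk_eq_zero _).mpr ?_
  change h.dH 2 2 (h.dC (BForm.ofVForm p Φ)) ∈ rangeDV p 3 2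
  rw [hc.dH_dC]
  exact Submodule.zero_mem _

/-- Two classes in `E₂^{a+1,q+1}` agree iff representatives differ by `d^H α + d^V β` with
`d^V α = 0`. -/
lemma E2_mk_eq_iff {a q : ℕ} (Θ Λ : BForm p (a + 1) (q + 1)) (hΘ : dV p (a + 1) (q + 1) Θ = 0)
    (hΛ : dV p (a + 1) (q + 1) Λ = 0)
    (hΘ' : h.d1 (a + 1) (q + 1) (E1.mk Θ hΘ) = 0) (hΛ' : h.d1 (a + 1) (q + 1) (E1.mk Λ hΛ) = 0) :
    E2.mk h (E1.mk Θ hΘ) hΘ' = E2.mk h (E1.mk Λ hΛ) hΛ' ↔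
      ∃ (α : BForm p a (q + 1)) (β : BForm p (a + 1) q), dV p a (q + 1) α = 0 ∧
        Θ - Λ = h.dH a (q + 1) α + dV p (a + 1) q β := by
  have e1 : E2.mk h (E1.mk Θ hΘ) hΘ' = E2.mk h (E1.mk Λ hΛ) hΛ' ↔
      ∃ ξ : E1 p a (q + 1), h.d1 a (q + 1) ξ = E1.mk Θ hΘ - E1.mk Λ hΛ :=
    Submodule.Quotient.eq _
  have e2 : ∀ (α : BForm p a (q + 1)) (hα : dV p a (q + 1) α = 0),
      h.d1 a (q + 1) (E1.mk α hα) = E1.mk Θ hΘ - E1.mk Λ hΛ ↔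
        ∃ β, dV p (a + 1) q β = h.dH a (q + 1) α - (Θ - Λ) := fun α hα =>
    Submodule.Quotient.eq _
  rw [e1]
  constructor
  · rintro ⟨ξ, hξ⟩
    obtain ⟨⟨α, hα⟩, rfl⟩ := Submodule.Quotient.mk_surjective _ ξ
    obtain ⟨β, hβ⟩ := (e2 α hα).mp hξ
    exact ⟨α, -β, hα, by rw [map_neg, hβ]; abel⟩
  · rintro ⟨α, β, hα, hβ⟩
    exact ⟨E1.mk α hα, (e2 α hα).mpr ⟨-β, by rw [map_neg, hβ]; abel⟩⟩

/-- The class `[d^C Φ_V]₂` vanishes iff the first two closedness equations have a solution. -/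
lemma IsCompatible.E2_mk_dC_eq_zero_iff (hc : h.IsCompatible Φ)
    (hV : dV p 2 2 (h.dC (BForm.ofVForm p Φ)) = 0)
    (hH : h.d1 2 2 (E1.mk (h.dC (BForm.ofVForm p Φ)) hV) = 0) :
    E2.mk h (E1.mk (h.dC (BForm.ofVForm p Φ)) hV) hH = 0 ↔
      ∃ (α : BForm p 1 2) (β : BForm p 2 1),
        h.dH 0 3 (BForm.ofVForm p Φ) + dV p 1 2 α = 0 ∧
        h.dC (BForm.ofVForm p Φ) + h.dH 1 2 α + dV p 2 1 β = 0 := by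
  have h0 : dV p 2 2 (0 : BForm p 2 2) = 0 := map_zero _
  have h0' : h.d1 2 2 (E1.mk 0 h0) = 0 := map_zero (h.d1 2 2)
  have hc0 : h.dH 0 3 (BForm.ofVForm p Φ) = 0 := hc
  refine (E2_mk_eq_iff (h := h) _ 0 hV h0 hH h0').trans ?_
  simp only [hc0, zero_add, sub_zero]
  constructor
  · rintro ⟨α, β, hα, e⟩
    exact ⟨-α, -β, by rw [map_neg, hα, neg_zero], by rw [e, map_neg, map_neg]; abel⟩
  · rintro ⟨α, β, hα, e⟩
    refine ⟨-α, -β, by rw [map_neg, hα, neg_zero], ?_⟩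
    rw [map_neg, map_neg, ← sub_eq_zero, ← e]
    abel

/-- For two compatible connections, `d^{C'} Φ_V - d^C Φ_V = -(d^H α + d^V β)`, where
`α(u) = i_{Y_u} Φ_V` and `β(u, v) = i_{Y_u} i_{Y_v} Φ_V` with `Y = h' - h`. -/
lemma IsCompatible.E2_mk_dC_eq (hc : h.IsCompatible Φ) (hc' : h'.IsCompatible Φ)
    (hcl : dVer p 3 Φ = 0)
    (hV : dV p 2 2 (h.dC (BForm.ofVForm p Φ)) = 0)
    (hV' : dV p 2 2 (h'.dC (BForm.ofVForm p Φ)) = 0)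
    (hH : h.d1 2 2 (E1.mk (h.dC (BForm.ofVForm p Φ)) hV) = 0)
    (hH' : h.d1 2 2 (E1.mk (h'.dC (BForm.ofVForm p Φ)) hV') = 0) :
    E2.mk h (E1.mk (h.dC (BForm.ofVForm p Φ)) hV) hH =
      E2.mk h (E1.mk (h'.dC (BForm.ofVForm p Φ)) hV') hH' := by
  have hcl' : ceD 3 Φ = 0 := hcl
  let Y := h.liftDiff h'
  have hY : ∀ u, ceLie (Y u) Φ = 0 := fun u => by
    have := h.lieHor_eq_add_ceLie h' u Φ
    rw [hc.lieHor_eq_zero, hc'.lieHor_eq_zero, zero_add] at this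
    exact this.symm
  have hdY : ∀ u, ceD 2 (Φ.curryLeft (Y u)) = 0 := fun u => by
    rw [ceD_curryLeft_of_closed _ hcl', hY]
  have hα : ∀ v, h.contractDiff h' (BForm.ofVForm p Φ) v = Φ.curryLeft (Y (v 0)) := fun v => by
    rw [contractDiff_apply]
    simp
    rfl
  let β : BForm p 2 1 := alternatingOfBilin
    (LinearMap.mk₂ (SmoothFn F B) (fun u v => (Φ.curryLeft (Y v)).curryLeft (Y u))
      (fun u v w => by rw [show Y (u + v) = Y u + Y v from h.liftDiff_add h' u v, map_add])
      (fun f u v => by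
        rw [show Y (f • u) = pullbackFn p f • Y u from h.liftDiff_smul h' f u, map_smul]; rfl)
      (fun u v w => by
        rw [show Y (v + w) = Y v + Y w from h.liftDiff_add h' v w, map_add]; rfl)
      (fun f u v => by
        rw [show Y (f • v) = pullbackFn p f • Y v from h.liftDiff_smul h' f v, map_smul]; rfl))
    (fun u => AlternatingMap.curryLeft_same Φ (Y u))
  refine (E2_mk_eq_iff (h := h) _ _ hV hV' hH hH').mpr
    ⟨h.contractDiff h' (BForm.ofVForm p Φ), β, ?_, ?_⟩
  · ext v : 1
    rw [dV_apply, hα]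
    change _ • ceD 2 _ = (0 : VForm p 3)
    rw [hdY, smul_zero]
  · ext v : 1
    -- `i_{[Y_u, Y_v]} Φ_V = L_{Y_u} i_{Y_v} Φ_V = d_V i_{Y_u} i_{Y_v} Φ_V`
    have hbr : Φ.curryLeft ⁅Y (v 0), Y (v 1)⁆ =
        ceD 1 ((Φ.curryLeft (Y (v 1))).curryLeft (Y (v 0))) := by
      rw [ceD_curryLeft_of_closed _ (hdY _), ceLie_curryLeft_of_invariant _ (hY _)]
    change h.dC (BForm.ofVForm p Φ) v - h'.dC (BForm.ofVForm p Φ) v =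
      h.dH 1 2 (h.contractDiff h' (BForm.ofVForm p Φ)) v + dV p 2 1 β v
    rw [dC_ofVForm_apply, dC_ofVForm_apply, h.dH_one_apply _ (fun u => Φ.curryLeft (Y u)) hα,
      hc.lieHor_curryLeft, hc.lieHor_curryLeft, dV_apply, h.curvature_eq_add h']
    have hβ : (-1 : ℤ) ^ 2 • dVer p 1 (β v) =
        ceD 1 ((Φ.curryLeft (Y (v 1))).curryLeft (Y (v 0))) := by
      rw [neg_one_sq, one_smul]; rfl
    rw [hβ, ← hbr]
    simp only [map_add, map_sub]
    change _ = _ - _ - _ + Φ.curryLeft ⁅h.liftDiff h' (v 0), h.liftDiff h' (v 1)⁆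
    simp only [Y]
    abel

/-- A closed extension `Ψ` solves the first two closedness equations through its components of
horizontal degree one and two: `α(u) = i_{h(u)} Ψ` and `β(u, v) = i_{h(v)} i_{h(u)} Ψ`, restricted to
the fibres. -/
lemma exists_closedness_solution_of_hasClosedExtension (h : EhresmannConnection p)
    (hext : HasClosedExtension Φ) :
    ∃ (α : BForm p 1 2) (β : BForm p 2 1),
        h.dH 0 3 (BForm.ofVForm p Φ) + dV p 1 2 α = 0 ∧
        h.dC (BForm.ofVForm p Φ) + h.dH 1 2 α + dV p 2 1 β = 0 := by
  obtain ⟨Ψ, hΨ, rfl⟩ := hext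
  -- `L_X Ψ = d i_X Ψ`
  have hLie : ∀ X : VField E M, ceLie X Ψ = ceD 2 (Ψ.curryLeft X) := fun X =>
    (ceD_curryLeft_of_closed X hΨ).symm
  let α : BForm p 1 2 := AlternatingMap.ofSubsingleton _ _ _ (0 : Fin 1)
    { toFun := fun u => DForm.vert p (Ψ.curryLeft (h.lift u))
      map_add' := fun u v => by rw [lift_add, map_add]; rfl
      map_smul' := fun f u => by rw [lift_smul, map_smul]; rfl }
  have hα : ∀ v, α v = DForm.vert p (Ψ.curryLeft (h.lift (v 0))) := fun _ => rfl
  let β : BForm p 2 1 := alternatingOfBilin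
    (LinearMap.mk₂ (SmoothFn F B)
      (fun u v => DForm.vert p ((Ψ.curryLeft (h.lift u)).curryLeft (h.lift v)))
      (fun u v w => by rw [lift_add, map_add]; rfl)
      (fun f u v => by rw [lift_smul, map_smul]; rfl)
      (fun u v w => by rw [lift_add, map_add]; rfl)
      (fun f u v => by rw [lift_smul, map_smul]; rfl))
    (fun u => by
      change DForm.vert p ((Ψ.curryLeft (h.lift u)).curryLeft (h.lift u)) = 0
      rw [AlternatingMap.curryLeft_same]; rfl)
  refine ⟨α, β, ?_, ?_⟩
  · ext v : 1
    change h.dH 0 3 (BForm.ofVForm p (Ψ.vert p)) v + dV p 1 2 α v = 0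
    rw [dH_ofVForm_apply, dV_apply, hα, DForm.dVer_vert, lieHor_vert, hLie, pow_one, neg_one_smul,
      add_neg_cancel]
  · ext v : 1
    have hβ : (-1 : ℤ) ^ 2 • dVer p 1 (β v) =
        DForm.vert p (ceD 1 ((Ψ.curryLeft (h.lift (v 0))).curryLeft (h.lift (v 1)))) := by
      rw [neg_one_sq, one_smul, ← DForm.dVer_vert]; rfl
    change h.dC (BForm.ofVForm p (Ψ.vert p)) v + h.dH 1 2 α v + dV p 2 1 β v = 0
    rw [dC_ofVForm_apply, h.dH_one_apply α (fun u => DForm.vert p (Ψ.curryLeft (h.lift u))) hα, dV_apply, hβ, lieHor_vert, lieHor_vert,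
      DForm.vert_curryLeft, coe_curvature]
    have e1 : ceLie (h.lift (v 0)) (Ψ.curryLeft (h.lift (v 1))) =
        (ceD 2 (Ψ.curryLeft (h.lift (v 0)))).curryLeft (h.lift (v 1)) +
          Ψ.curryLeft ⁅h.lift (v 0), h.lift (v 1)⁆ := by
      rw [ceLie_curryLeft, hLie]
    rw [e1, ← ceD_cartan (h.lift (v 1)), map_sub]
    simp only [DForm.vert_add, DForm.vert_sub]
    abel

end Compatible

end EhresmannConnection

end Vertical

end

theorem mainTheorem8 {E F M B : Type*}
    [NormedAddCommGroup E] [NormedSpace ℝ E] [FiniteDimensional ℝ E]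
    [NormedAddCommGroup F] [NormedSpace ℝ F] [FiniteDimensional ℝ F]
    [TopologicalSpace M] [ChartedSpace E M] [IsManifold 𝓘(ℝ, E) ∞ M] [T2Space M]
    [TopologicalSpace B] [ChartedSpace F B] [IsManifold 𝓘(ℝ, F) ∞ B] [T2Space B]
    (p : C^∞⟮𝓘(ℝ, E), M; 𝓘(ℝ, F), B⟯) (Φ : VForm p 3) (hΦ : IsTwoPlecticFibration p Φ) :
    -- for each compatible connection, the class `[d^C Φ_V]₂` is defined, it vanishes if and only if
    -- the first closedness equations can be solved, and it vanishes if a closed extension exists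
    (∀ h : EhresmannConnection p, h.IsCompatible Φ →
      ∃ (hV : dV p 2 2 (h.dC (BForm.ofVForm p Φ)) = 0)
        (hH : h.d1 2 2 (E1.mk (h.dC (BForm.ofVForm p Φ)) hV) = 0),
        (EhresmannConnection.E2.mk h (E1.mk (h.dC (BForm.ofVForm p Φ)) hV) hH = 0 ↔
          ∃ (α : BForm p 1 2) (β : BForm p 2 1),
            h.dH 0 3 (BForm.ofVForm p Φ) + dV p 1 2 α = 0 ∧
            h.dC (BForm.ofVForm p Φ) + h.dH 1 2 α + dV p 2 1 β = 0) ∧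
        (HasClosedExtension Φ →
          EhresmannConnection.E2.mk h (E1.mk (h.dC (BForm.ofVForm p Φ)) hV) hH = 0)) ∧
    -- `d₁`, hence `H^a(B, H^q(Ver))`, does not depend on the connection
    (∀ (h h' : EhresmannConnection p) (a q : ℕ), h.d1 a q = h'.d1 a q) ∧
    -- `[d^C Φ_V]₂` does not depend on the compatible connection
    (∀ h h' : EhresmannConnection p, h.IsCompatible Φ → h'.IsCompatible Φ →
      ∃ (hV : dV p 2 2 (h.dC (BForm.ofVForm p Φ)) = 0)
        (hV' : dV p 2 2 (h'.dC (BForm.ofVForm p Φ)) = 0)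
        (hH : h.d1 2 2 (E1.mk (h.dC (BForm.ofVForm p Φ)) hV) = 0)
        (hH' : h.d1 2 2 (E1.mk (h'.dC (BForm.ofVForm p Φ)) hV') = 0),
        EhresmannConnection.E2.mk h (E1.mk (h.dC (BForm.ofVForm p Φ)) hV) hH =
          EhresmannConnection.E2.mk h (E1.mk (h'.dC (BForm.ofVForm p Φ)) hV') hH') := by
  refine ⟨fun h hc => ?_, fun h h' a q => h.d1_eq h' a q, fun h h' hc hc' => ?_⟩
  · have hV := hc.dV_dC hΦ.closed
    have hH := hc.d1_dC hV
    have hiff := hc.E2_mk_dC_eq_zero_iff hV hH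
    exact ⟨hV, hH, hiff, fun hext =>
      hiff.mpr (h.exists_closedness_solution_of_hasClosedExtension hext)⟩
  · have hV := hc.dV_dC hΦ.closed
    have hV' := hc'.dV_dC hΦ.closed
    have hH := hc.d1_dC hV
    have hH' : h.d1 2 2 (E1.mk (h'.dC (BForm.ofVForm p Φ)) hV') = 0 := by
      rw [h.d1_eq h']
      exact hc'.d1_dC hV'
    exact ⟨hV, hV', hH, hH', hc.E2_mk_dC_eq hc' hΦ.closed hV hV' hH hH'⟩
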